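/- Let $n\ge 3$, let $a_1,\dots,a_n$ be distinct points of the Riemann sphere $\mathbb{CP}^1=\mathbb C\cup\{\infty\}$, and let $f:\mathbb H\to X:=\mathbb{CP}^1\setminus\{a_1,\dots,a_n\}$ be a holomorphic universal covering, where $\mathbb H$ is the upper half plane. Let $\operatorname{Aut}(f)$ be its deck transformation group, i.e. the group of homeomorphisms $\gamma:\mathbb H\to\mathbb H$ with $f\circ\gamma=f$. Say that a loop $l$ in $X$ is a loop around the single puncture $a_j$ if it is freely homotopic in $X$ to the boundary circle, traversed once in the positive direction, of a closed round disc centered at $a_j$ (in the coordinate $z-a_j$ if $a_j\neq\infty$, and $1/z$ if $a_j=\infty$) that contains no other puncture. For $\tau_0\in\mathbb H$ and a loop $l$ based at $f(\tau_0)$, say that $\gamma\in\operatorname{Aut}(f)$ corresponds to $l$ (with respect to $\tau_0$) if the lift of $l$ starting at $\tau_0$ ends at $\gamma(\tau_0)$. 1. For every $\tau_0\in\mathbb H$ and every $k\in\{1,\dots,n\}$, the group $\operatorname{Aut}(f)$ is a free group on $n-1$ generators $\gamma_j$ ($1\le j\le n$, $j\ne k$), where each $\gamma_j$ corresponds to a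 loop based at $f(\tau_0)$ around the single puncture $a_j$, and acts on $\mathbb H$ as a parabolic element of $\mathrm{SL}_2(\mathbb R)$, i.e. a non-scalar matrix with exactly one fixed point on $\mathbb R\cup\{\infty\}$. 2. Every $\gamma\in\operatorname{Aut}(f)$ that corresponds, with respect to some $\tau_0\in\mathbb H$, to a loop based at $f(\tau_0)$ around a single puncture $a_j$ ($1\le j\le n$) acts on $\mathbb H$ as a parabolic element of $\mathrm{SL}_2(\mathbb R)$. -/

import Mathlib

open scoped UpperHalfPlane MatrixGroups unitInterval Topology

noncomputable section

/-- The Riemann sphere `ℂℙ¹ = ℂ ∪ {∞}` (with its topology of one-point compactification) with the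
points `a₁, …, aₙ` removed. -/
abbrev PuncturedSphere {n : ℕ} (a : Fin n → OnePoint ℂ) : Type :=
  {x : OnePoint ℂ // x ∉ Set.range a}

/-- The standard holomorphic local parametrization of the Riemann sphere which maps `0` to `p`:
`w ↦ c + w` if `p = c` is finite, and `w ↦ 1 / w` (with `0 ↦ ∞`) if `p = ∞`. -/
def sphereParam : OnePoint ℂ → ℂ → OnePoint ℂ
  | some c, w => ((c + w : ℂ) : OnePoint ℂ)
  | none, w => if w = 0 then OnePoint.infty else ((w⁻¹ : ℂ) : OnePoint ℂ)

/-- `g : ℍ → ℂℙ¹` is holomorphic: near each `τ`, in the standard local coordinate centered at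
`g τ`, it is given by a holomorphic function. -/
def IsHolomorphicToSphere (g : ℍ → OnePoint ℂ) : Prop :=
  ∀ τ : ℍ, ∃ u : ℂ → ℂ, AnalyticAt ℂ u (τ : ℂ) ∧
    ∀ᶠ z : ℍ in 𝓝 τ, g z = sphereParam (g τ) (u (z : ℂ))

/-- A (holomorphic) universal covering `f : ℍ → ℂℙ¹ ∖ {a₁, …, aₙ}`. As `ℍ` is simply connected,
universality needs no separate requirement. -/
structure IsUniversalCovering {n : ℕ} (a : Fin n → OnePoint ℂ)
    (f : ℍ → PuncturedSphere a) : Prop where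
  isCoveringMap : IsCoveringMap f
  surjective : Function.Surjective f
  holomorphic : IsHolomorphicToSphere fun τ => (f τ : OnePoint ℂ)

/-- The deck transformation group `Aut(f)`: the self-homeomorphisms `γ` of `E` with `f ∘ γ = f`,
under composition. -/
def deckGroup {E X : Type*} [TopologicalSpace E] (f : E → X) : Subgroup (E ≃ₜ E) where
  carrier := {γ | ∀ z, f (γ z) = f z}
  mul_mem' := by
    intro γ δ hγ hδ z
    exact (hγ (δ z)).trans (hδ z)
  one_mem' := fun _ => rfl
  inv_mem' := by
    intro γ hγ z
    have h := hγ (γ⁻¹ z)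
    have e : γ (γ⁻¹ z) = z := γ.apply_symm_apply z
    rw [e] at h
    exact h.symm

/-- The loop `l` circles once, positively, around the single puncture `p`: for some radius `r > 0`
such that the closed coordinate disc of radius `r` around `p` contains no puncture other than `p`,
the loop `l` is freely homotopic, within the punctured sphere, to the boundary circle
`t ↦ r e^{2πit}` of that disc. -/
def IsLoopAround {n : ℕ} {a : Fin n → OnePoint ℂ} {x : PuncturedSphere a}
    (p : OnePoint ℂ) (l : Path x x) : Prop :=
  ∃ r : ℝ, 0 < r ∧
    (∀ j, a j ≠ p → a j ∉ sphereParam p '' Metric.closedBall (0 : ℂ) r) ∧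
    ∃ H : C(I × I, PuncturedSphere a),
      (∀ t, H (0, t) = l t) ∧
      (∀ t : I, (H (1, t) : OnePoint ℂ) =
        sphereParam p (r * Complex.exp (2 * Real.pi * Complex.I * ((t : ℝ) : ℂ)))) ∧
      ∀ s, H (s, 0) = H (s, 1)

/-- The transformation `γ` corresponds to the loop `l` (with respect to the point `e` of the fiber
over the base point of `l`): the lift of `l` starting at `e` ends at `γ e`. -/
def CorrespondsToLoop {E X : Type*} [TopologicalSpace E] [TopologicalSpace X] (f : E → X) (e : E)
    (γ : E ≃ₜ E) (l : Path (f e) (f e)) : Prop :=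
  ∃ L : Path e (γ e), ∀ t, f (L t) = l t

/-- The self-map `γ` of `ℍ` is given by a parabolic element of `SL₂(ℝ)`. -/
def IsParabolicTransformation (γ : ℍ ≃ₜ ℍ) : Prop :=
  ∃ A : SL(2, ℝ), (A : Matrix (Fin 2) (Fin 2) ℝ).IsParabolic ∧ ∀ τ : ℍ, γ τ = A • τ

end

/-! ### Deck transformations of a simply connected covering. -/

section DeckTransformations

/-! Freeness is topological. An affine coordinate sending `a k` to `∞` turns `X` into a plane with
`n - 1` punctures. Cut it along parallel rays ending at the punctures. The slit plane and a thin
strip around each ray are simply connected, so the covering has sections over them, and across the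
`j`-th ray the sections are glued by a deck transformation `γ j`. The `γ j` generate because `E` is
connected. They satisfy no relation because the word of cuts crossed is a locally constant cocycle,
which is trivial on the simply connected `E` and so gives a left inverse to the map from the free
group (`exists_freeGroupBasis_of_cuts`).

Loops around a puncture are handled through a map `g` from the half plane, seen as the universal
covering of a punctured disc, which lifts `z ↦ r * exp (2πiz)` and satisfies `g (z + 1) = γ (g z)`.
Such a `g` exists for each generator, yields a loop around the puncture over any base point, and
conversely arises from any `γ` that corresponds to such a loop.

Parabolicity is the Schwarz-Pick lemma. Deck transformations are holomorphic automorphisms, hence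
lie in `SL(2, ℝ)`, and nontrivial ones have no fixed point in `ℍ`, so they are not elliptic. The
points `iy` and `iy + 1` become arbitrarily close in the hyperbolic metric as `y → ∞`, hence so do
`g (iy)` and its image under `γ`; a hyperbolic element has positive minimal displacement, so `γ` is
parabolic (`isParabolic_of_holomorphic_period`). For an arbitrary loop around `a j`, the
transformation is nontrivial because it is conjugate to a member of a free basis. -/

theorem apply_deckGroup {E X : Type*} [TopologicalSpace E] {f : E → X} (γ : deckGroup f) (z : E) :
    f ((γ : E ≃ₜ E) z) = f z :=
  γ.2 z

variable {E X : Type*} [TopologicalSpace E] [TopologicalSpace X] {f : E → X}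

theorem deckGroup_ext [PreconnectedSpace E] (hf : IsCoveringMap f) {γ δ : deckGroup f} {z : E}
    (h : (γ : E ≃ₜ E) z = (δ : E ≃ₜ E) z) : γ = δ := by
  apply Subtype.ext
  apply Homeomorph.ext
  have := hf.eq_of_comp_eq (g₁ := (γ : E ≃ₜ E)) (g₂ := (δ : E ≃ₜ E))
    (Homeomorph.continuous _) (Homeomorph.continuous _)
    (by ext x; simp [apply_deckGroup]) z h
  exact fun x => congrFun this x

/-- The covering is lifted through itself, once from `x` to `y` and once back; uniqueness of lifts
makes the two maps mutually inverse. -/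
theorem exists_deckGroup_apply_eq [SimplyConnectedSpace E] [LocallyPathConnectedSpace E]
    (hf : IsCoveringMap f) {x y : E} (h : f x = f y) :
    ∃ γ : deckGroup f, (γ : E ≃ₜ E) x = y := by
  obtain ⟨g, ⟨hg, hfg⟩, -⟩ := hf.existsUnique_continuousMap_lifts ⟨f, hf.continuous⟩ x y h.symm
  obtain ⟨g', ⟨hg', hfg'⟩, -⟩ := hf.existsUnique_continuousMap_lifts ⟨f, hf.continuous⟩ y x h
  have e : ∀ z, f (g z) = f z := congrFun hfg
  have e' : ∀ z, f (g' z) = f z := congrFun hfg'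
  have h1 : (g' : E → E) ∘ g = id :=
    hf.eq_of_comp_eq (by fun_prop) continuous_id (by ext z; simp [e, e']) x (by simp [hg, hg'])
  have h2 : (g : E → E) ∘ g' = id :=
    hf.eq_of_comp_eq (by fun_prop) continuous_id (by ext z; simp [e, e']) y (by simp [hg, hg'])
  exact ⟨⟨⟨⟨g, g', congrFun h1, congrFun h2⟩, g.continuous, g'.continuous⟩, e⟩, hg⟩

/-- Two local lifts of the same map which agree at a point agree near it. -/
theorem eventually_eq_of_lifts (hf : IsCoveringMap f) {A : Type*} [TopologicalSpace A]
    {g h : A → E} {a : A} (hg : ContinuousAt g a) (hh : ContinuousAt h a)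
    (hfgh : ∀ᶠ x in 𝓝 a, f (g x) = f (h x)) (ha : g a = h a) : ∀ᶠ x in 𝓝 a, g x = h x := by
  obtain ⟨W, hW, haW, hinj⟩ := hf.isLocalHomeomorph.isLocallyInjective (g a)
  have h1 := hg.eventually (hW.mem_nhds haW)
  have h2 := hh.eventually (hW.mem_nhds (ha ▸ haW))
  filter_upwards [h1, h2, hfgh] with x h1 h2 h3 using hinj h1 h2 h3

end DeckTransformations

/-! ### Locally constant cocycles on a simply connected space. -/

section Cocycles

/-- On a simply connected space, a cocycle of the form `h i * (h j)⁻¹` with locally constant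
quotients is a locally constant coboundary. -/
theorem exists_mul_inv_eventually_eq {E ι K : Type*} [TopologicalSpace E] [SimplyConnectedSpace E]
    [LocallyPathConnectedSpace E] [Group K] (V : ι → Set E) (hV : ∀ i, IsOpen (V i))
    (hcov : ∀ z, ∃ i, z ∈ V i) (h : ι → E → K)
    (hloc : ∀ i j, ∀ z ∈ V i ∩ V j,
      ∀ᶠ z' in 𝓝 z, h i z' * (h j z')⁻¹ = h i z * (h j z)⁻¹) :
    ∃ c : E → K, ∀ i, ∀ z ∈ V i, ∀ᶠ z' in 𝓝 z, c z' * (h i z')⁻¹ = c z * (h i z)⁻¹ := by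
  classical
  let _ : TopologicalSpace K := ⊥
  have : DiscreteTopology K := ⟨rfl⟩
  choose idx hidx using hcov
  -- The cocycle glues copies of `K`, with the discrete topology, into a bundle. This is a covering
  -- of a simply connected space, so it has a continuous global section `ρ`.
  let Z : FiberBundleCore ι E K :=
    { baseSet := V
      isOpen_baseSet := hV
      indexAt := idx
      mem_baseSet_at := hidx
      coordChange := fun i j z k => k * (h i z * (h j z)⁻¹)
      coordChange_self := by simp
      continuousOn_coordChange := by
        intro i j
        rintro ⟨z, k⟩ ⟨hz, -⟩
        apply ContinuousAt.continuousWithinAt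
        have h1 : ∀ᶠ p : E × K in 𝓝 (z, k),
            k * (h i z * (h j z)⁻¹) = p.2 * (h i p.1 * (h j p.1)⁻¹) := by
          have h2 : ∀ᶠ p : E × K in 𝓝 (z, k), p.2 = k :=
            (continuous_snd.tendsto (z, k)).eventually (p := (· = k)) (by simp)
          have h3 := (continuous_fst.tendsto (z, k)).eventually (hloc i j z hz)
          filter_upwards [h2, h3] with p h2 h3
          rw [h2, h3]
        exact (continuousAt_const (y := k * (h i z * (h j z)⁻¹))).congr h1
      coordChange_comp := by
        intro i j k z _ v
        group }
  have hcovm : IsCoveringMap (Bundle.TotalSpace.proj : Bundle.TotalSpace K Z.Fiber → E) :=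
    FiberBundle.isCoveringMap
  obtain ⟨z0⟩ : Nonempty E := inferInstance
  obtain ⟨ρ, ⟨-, hρ⟩, -⟩ := hcovm.existsUnique_continuousMap_lifts (ContinuousMap.id E) z0
    ⟨z0, (1 : K)⟩ rfl
  have hproj : ∀ z, (ρ z).1 = z := congrFun hρ
  let v : E → K := fun z => (ρ z).2
  -- The factor `h (idx z) z` removes the dependence on the preferred chart: `c * (h i)⁻¹` is the
  -- section read in chart `i`, a continuous map to a discrete space.
  refine ⟨fun z => v z * h (idx z) z, fun i z hz => ?_⟩
  have hsrc : ρ z ∈ (Z.localTriv i).source := by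
    rw [FiberBundleCore.mem_localTriv_source, hproj]
    exact hz
  have hcont : ContinuousAt (fun z' => (Z.localTriv i (ρ z')).2) z :=
    continuous_snd.continuousAt.comp
      (((Z.localTriv i).continuousAt hsrc).comp ρ.continuous.continuousAt)
  have hval : ∀ z', (Z.localTriv i (ρ z')).2 = v z' * h (idx z') z' * (h i z')⁻¹ := by
    intro z'
    rw [FiberBundleCore.localTriv_apply]
    change v z' * (h (idx (ρ z').1) (ρ z').1 * (h i (ρ z').1)⁻¹) = _
    rw [hproj, mul_assoc]
  have := hcont.eventually (show {(Z.localTriv i (ρ z)).2} ∈ 𝓝 _ by simp [nhds_discrete])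
  filter_upwards [this] with z' hz'
  rw [← hval, ← hval]
  exact hz'

end Cocycles

theorem IsPreconnected.eq_of_eventually_eq {A Y : Type*} [TopologicalSpace A] {S : Set A}
    (hS : IsPreconnected S) {g : A → Y} (hg : ∀ x ∈ S, ∀ᶠ x' in 𝓝[S] x, g x' = g x) {x y : A}
    (hx : x ∈ S) (hy : y ∈ S) : g x = g y := by
  let _ : TopologicalSpace Y := ⊥
  have : DiscreteTopology Y := ⟨rfl⟩
  refine hS.constant (f := g) (fun z hz => ?_) hx hy
  have := hg z hz
  rw [ContinuousWithinAt, nhds_discrete, Filter.tendsto_pure]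
  exact this

/-! ### A free basis from cuts of the base. -/

section FreeBasis

variable {E X J : Type*} [TopologicalSpace E] [TopologicalSpace X] [SimplyConnectedSpace E]
  [LocallyPathConnectedSpace E]

/-- Cutting the base of a simply connected covering: if `X` is covered by a connected open set `U`
and disjoint connected open sets `O j`, over all of which the covering has a section, such that
`U ∩ O j` has two parts, on the first of which the sections agree and on the second of which they
differ by `γ j`, then the `γ j` form a free basis of the deck transformation group. -/
theorem exists_freeGroupBasis_of_cuts {f : E → X} (hf : IsCoveringMap f) {U : Set X}
    {O P N : J → Set X} (hUo : IsOpen U) (hOo : ∀ j, IsOpen (O j)) (hPo : ∀ j, IsOpen (P j))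
    (hNo : ∀ j, IsOpen (N j)) (hUc : IsPreconnected U) (hOc : ∀ j, IsPreconnected (O j))
    (hcov : ∀ x, x ∈ U ∨ ∃ j, x ∈ O j) (hdisj : ∀ i j, i ≠ j → Disjoint (O i) (O j))
    (hUO : ∀ j, U ∩ O j = P j ∪ N j) (hPN : ∀ j, Disjoint (P j) (N j))
    (hPne : ∀ j, (P j).Nonempty) (hNne : ∀ j, (N j).Nonempty) (hUne : U.Nonempty)
    {s : X → E} (hs : ContinuousOn s U) (hfs : ∀ x ∈ U, f (s x) = x)
    {t : J → X → E} (ht : ∀ j, ContinuousOn (t j) (O j)) (hft : ∀ j, ∀ x ∈ O j, f (t j x) = x)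
    (γ : J → deckGroup f) (htP : ∀ j, ∀ x ∈ P j, t j x = s x)
    (htN : ∀ j, ∀ x ∈ N j, t j x = (γ j : E ≃ₜ E) (s x)) :
    ∃ b : FreeGroupBasis J (deckGroup f), ∀ j, b j = γ j := by
  classical
  obtain ⟨u0, hu0⟩ := hUne
  have hfc := hf.continuous
  have hd : ∀ (g : deckGroup f) (z : E), f ((g : E ≃ₜ E) z) = f z := apply_deckGroup
  have hPU : ∀ j, P j ⊆ U := fun j x hx => ((hUO j).symm ▸ Or.inl hx : x ∈ U ∩ O j).1
  have hPO : ∀ j, P j ⊆ O j := fun j x hx => ((hUO j).symm ▸ Or.inl hx : x ∈ U ∩ O j).2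
  have hNU : ∀ j, N j ⊆ U := fun j x hx => ((hUO j).symm ▸ Or.inr hx : x ∈ U ∩ O j).1
  have hNO : ∀ j, N j ⊆ O j := fun j x hx => ((hUO j).symm ▸ Or.inr hx : x ∈ U ∩ O j).2
  -- surjectivity
  have hsurj : Function.Surjective (FreeGroup.lift γ) := by
    rw [← MonoidHom.range_eq_top]
    set G' := (FreeGroup.lift γ).range with hG'
    have hγG : ∀ j, γ j ∈ G' := fun j => ⟨FreeGroup.of j, by simp⟩
    -- `A` is the union of the `G'`-translates of the sheets `s U` and `t j (O j)`. It turns out to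
    -- be open and closed, hence everything, and a deck transformation keeping `s u0` in `A` lies in
    -- `G'`.
    let A : Set E := {z | (f z ∈ U ∧ ∃ g ∈ G', z = (g : E ≃ₜ E) (s (f z))) ∨
      ∃ j, f z ∈ O j ∧ ∃ g ∈ G', z = (g : E ≃ₜ E) (t j (f z))}
    have hAU : ∀ z, f z ∈ U → (z ∈ A ↔ ∃ g ∈ G', z = (g : E ≃ₜ E) (s (f z))) := by
      intro z hz
      refine ⟨?_, fun h => Or.inl ⟨hz, h⟩⟩
      rintro (⟨-, h⟩ | ⟨j, hj, g, hg, h⟩)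
      · exact h
      · rcases (hUO j ▸ ⟨hz, hj⟩ : f z ∈ P j ∪ N j) with h' | h'
        · exact ⟨g, hg, by rw [← htP j _ h']; exact h⟩
        · exact ⟨g * γ j, G'.mul_mem hg (hγG j), by rw [htN j _ h'] at h; exact h⟩
    have hAO : ∀ z j, f z ∈ O j → (z ∈ A ↔ ∃ g ∈ G', z = (g : E ≃ₜ E) (t j (f z))) := by
      intro z j hz
      refine ⟨?_, fun h => Or.inr ⟨j, hz, h⟩⟩
      rintro (⟨hU, g, hg, h⟩ | ⟨i, hi, h⟩)
      · rcases (hUO j ▸ ⟨hU, hz⟩ : f z ∈ P j ∪ N j) with h' | h'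
        · exact ⟨g, hg, by rw [htP j _ h']; exact h⟩
        · refine ⟨g * (γ j)⁻¹, G'.mul_mem hg (G'.inv_mem (hγG j)), ?_⟩
          rw [htN j _ h']
          change z = (g : E ≃ₜ E) ((γ j : E ≃ₜ E).symm ((γ j : E ≃ₜ E) (s (f z))))
          rw [Homeomorph.symm_apply_apply]
          exact h
      · by_cases hij : i = j
        · exact hij ▸ h
        · exact absurd hz (Set.disjoint_left.1 (hdisj i j hij) hi)
    -- Near `z` all points lie on one translate `h` of the sheet, and membership in `A` there just
    -- says `h ∈ G'`.
    have key : ∀ (S : Set X) (ρ : X → E), IsOpen S → ContinuousOn ρ S → (∀ x ∈ S, f (ρ x) = x) →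
        (∀ z, f z ∈ S → (z ∈ A ↔ ∃ g ∈ G', z = (g : E ≃ₜ E) (ρ (f z)))) →
        ∀ z, f z ∈ S → ∀ᶠ z' in 𝓝 z, (z' ∈ A ↔ z ∈ A) := by
      intro S ρ hS hρ hfρ hA z hz
      obtain ⟨h, hh⟩ := exists_deckGroup_apply_eq hf (x := ρ (f z)) (y := z) (hfρ _ hz)
      have hSz : ∀ᶠ z' in 𝓝 z, f z' ∈ S := hfc.continuousAt.eventually (hS.mem_nhds hz)
      have hev : ∀ᶠ z' in 𝓝 z, (h : E ≃ₜ E) (ρ (f z')) = z' := by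
        refine eventually_eq_of_lifts hf (h := id) ?_ continuousAt_id ?_ hh
        · exact (h : E ≃ₜ E).continuous.continuousAt.comp
            ((hρ.continuousAt (hS.mem_nhds hz)).comp hfc.continuousAt)
        · filter_upwards [hSz] with z' hz'
          rw [hd, hfρ _ hz', id]
      have hiff : ∀ z', f z' ∈ S → (h : E ≃ₜ E) (ρ (f z')) = z' → (z' ∈ A ↔ h ∈ G') := by
        intro z' hz' he
        rw [hA z' hz']
        constructor
        · rintro ⟨g, hg, hgz⟩
          have : h = g := deckGroup_ext hf (he.trans hgz)
          exact this ▸ hg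
        · exact fun hG => ⟨h, hG, he.symm⟩
      filter_upwards [hSz, hev] with z' h1 h2
      rw [hiff z' h1 h2, hiff z hz hh]
    have hloc : ∀ z, ∀ᶠ z' in 𝓝 z, (z' ∈ A ↔ z ∈ A) := by
      intro z
      rcases hcov (f z) with h | ⟨j, h⟩
      · exact key U s hUo hs hfs hAU z h
      · exact key (O j) (t j) (hOo j) (ht j) (hft j) (fun z hz => hAO z j hz) z h
    have hall : ∀ z w : E, z ∈ A → w ∈ A := by
      intro z w hz
      have := (isPreconnected_univ (α := E)).eq_of_eventually_eq (g := fun z => z ∈ A)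
        (fun x _ => by
          rw [nhdsWithin_univ]
          filter_upwards [hloc x] with x' hx' using propext hx')
        (Set.mem_univ z) (Set.mem_univ w)
      exact this ▸ hz
    rw [Subgroup.eq_top_iff']
    intro g
    have h0 : s u0 ∈ A := Or.inl ⟨by rwa [hfs _ hu0], 1, G'.one_mem, by rw [hfs _ hu0]; rfl⟩
    have hg := hall _ ((g : E ≃ₜ E) (s u0)) h0
    rw [hAU _ (by rwa [hd, hfs _ hu0]), hd, hfs _ hu0] at hg
    obtain ⟨g', hg', he⟩ := hg
    exact deckGroup_ext hf he ▸ hg'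
  -- a left inverse
  obtain ⟨Φ, hΦ⟩ : ∃ Φ : deckGroup f →* FreeGroup J, ∀ j, Φ (γ j) = FreeGroup.of j := by
    -- The index `none` stands for `U` and `some j` for `O j`; passing between them counts one
    -- generator on `N j` and nothing on `P j`.
    let h : Option J → X → FreeGroup J := fun i x =>
      i.elim 1 fun j => if x ∈ N j then FreeGroup.of j else 1
    let V : Option J → Set X := fun i => i.elim U O
    have hVo : ∀ i, IsOpen (V i) := by
      rintro (_ | j)
      exacts [hUo, hOo j]
    have hUOloc : ∀ j, ∀ x ∈ U ∩ O j, ∀ᶠ x' in 𝓝 x, h (some j) x' = h (some j) x := by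
      intro j x hx
      rcases (hUO j ▸ hx : x ∈ P j ∪ N j) with h' | h'
      · filter_upwards [(hPo j).mem_nhds h'] with x' hx'
        have e1 : x ∉ N j := Set.disjoint_left.1 (hPN j) h'
        have e2 : x' ∉ N j := Set.disjoint_left.1 (hPN j) hx'
        simp [h, e1, e2]
      · filter_upwards [(hNo j).mem_nhds h'] with x' hx'
        simp [h, h', hx']
    have hVloc : ∀ i i', ∀ x ∈ V i ∩ V i',
        ∀ᶠ x' in 𝓝 x, h i x' * (h i' x')⁻¹ = h i x * (h i' x)⁻¹ := by
      rintro (_ | i) (_ | j) x hx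
      · simp [h]
      · filter_upwards [hUOloc j x hx] with x' hx'
        rw [hx']
        rfl
      · filter_upwards [hUOloc i x hx.symm] with x' hx'
        rw [hx']
        rfl
      · by_cases hij : i = j
        · simp [hij]
        · exact absurd hx.2 (Set.disjoint_left.1 (hdisj i j hij) hx.1)
    obtain ⟨c, hc⟩ := exists_mul_inv_eventually_eq (fun i => f ⁻¹' V i)
      (fun i => (hVo i).preimage hfc)
      (fun z => (hcov (f z)).elim (fun h => ⟨none, h⟩) fun ⟨j, h⟩ => ⟨some j, h⟩)
      (fun i z => h i (f z))
      (fun i j z hz => hfc.continuousAt.eventually (hVloc i j (f z) hz))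
    have hconst : ∀ (i) (S : Set X) (ρ : X → E), S ⊆ V i → IsPreconnected S → ContinuousOn ρ S →
        (∀ x ∈ S, f (ρ x) = x) → ∀ x ∈ S, ∀ y ∈ S,
        c (ρ x) * (h i x)⁻¹ = c (ρ y) * (h i y)⁻¹ := by
      intro i S ρ hSV hS hρ hfρ x hx y hy
      refine hS.eq_of_eventually_eq (g := fun x => c (ρ x) * (h i x)⁻¹) (fun x hx => ?_) hx hy
      have := (hρ x hx).eventually (hc i (ρ x) (by rw [Set.mem_preimage, hfρ x hx]; exact hSV hx))
      filter_upwards [this, self_mem_nhdsWithin] with x' h1 h2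
      rwa [hfρ x hx, hfρ x' h2] at h1
    have hdeck : ∀ (g : deckGroup f) (z w : E),
        c ((g : E ≃ₜ E) z) * (c z)⁻¹ = c ((g : E ≃ₜ E) w) * (c w)⁻¹ := by
      intro g z w
      refine (isPreconnected_univ (α := E)).eq_of_eventually_eq
        (g := fun z => c ((g : E ≃ₜ E) z) * (c z)⁻¹) (fun z _ => ?_)
        (Set.mem_univ z) (Set.mem_univ w)
      rw [nhdsWithin_univ]
      obtain ⟨i, hi⟩ : ∃ i, f z ∈ V i :=
        (hcov (f z)).elim (fun h => ⟨none, h⟩) fun ⟨j, h⟩ => ⟨some j, h⟩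
      have h1 := hc i z hi
      have h2 := (g : E ≃ₜ E).continuous.continuousAt.eventually
        (hc i ((g : E ≃ₜ E) z) (by rw [Set.mem_preimage, hd]; exact hi))
      filter_upwards [h1, h2] with z' h1 h2
      simp only [hd] at h2
      calc c ((g : E ≃ₜ E) z') * (c z')⁻¹
          = (c ((g : E ≃ₜ E) z') * (h i (f z'))⁻¹) * (c z' * (h i (f z'))⁻¹)⁻¹ := by group
        _ = c ((g : E ≃ₜ E) z) * (c z)⁻¹ := by rw [h1, h2]; group
    -- By `hdeck` the quotient of `c` at `g z` and `z` does not depend on `z`, hence is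
    -- multiplicative in `g`. Conjugation by `κ` normalizes it so that `γ j` goes exactly to the
    -- generator.
    let κ := c (s u0)
    refine ⟨MonoidHom.mk' (fun g => κ⁻¹ * (c ((g : E ≃ₜ E) (s u0)) * κ⁻¹) * κ) ?_, fun j => ?_⟩
    · intro g g'
      have := hdeck g ((g' : E ≃ₜ E) (s u0)) (s u0)
      rw [← this]
      change κ⁻¹ * (c ((g : E ≃ₜ E) ((g' : E ≃ₜ E) (s u0))) * κ⁻¹) * κ = _
      group
    · obtain ⟨p, hp⟩ := hPne j
      obtain ⟨q, hq⟩ := hNne j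
      have e1 := hconst none U s subset_rfl hUc hs hfs u0 hu0 p (hPU j hp)
      have e2 := hconst none U s subset_rfl hUc hs hfs u0 hu0 q (hNU j hq)
      have e3 := hconst (some j) (O j) (t j) subset_rfl (hOc j) (ht j) (hft j) p (hPO j hp) q
        (hNO j hq)
      have hpN : p ∉ N j := Set.disjoint_left.1 (hPN j) hp
      have e4 := hdeck (γ j) (s u0) (s q)
      simp only [h, Option.elim, hpN, hq, if_true, if_false, inv_one, mul_one, htP j p hp,
        htN j q hq] at e1 e2 e3
      change κ⁻¹ * (c ((γ j : E ≃ₜ E) (s u0)) * (c (s u0))⁻¹) * κ = _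
      rw [e4, mul_inv_eq_iff_eq_mul.1 e3.symm, ← e2, ← e1]
      simp only [κ]
      group
  have hinj : Function.Injective (FreeGroup.lift γ) := by
    have hcomp : Φ.comp (FreeGroup.lift γ) = MonoidHom.id _ := by
      ext j
      simp [hΦ]
    exact Function.LeftInverse.injective (g := Φ) fun x => DFunLike.congr_fun hcomp x
  refine ⟨⟨(MulEquiv.ofBijective (FreeGroup.lift γ) ⟨hinj, hsurj⟩).symm⟩, fun j => ?_⟩
  change FreeGroup.lift γ (FreeGroup.of j) = γ j
  simp

end FreeBasis

/-! ### Sections over simply connected open sets. -/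

section Sections

/-- A covering map has a section, with a prescribed value, over an open set which is the image of a
simply connected space. -/
theorem IsCoveringMap.exists_section {E X A : Type*} [TopologicalSpace E] [TopologicalSpace X]
    [TopologicalSpace A] [SimplyConnectedSpace A] [LocallyPathConnectedSpace A] {f : E → X}
    (hf : IsCoveringMap f) {i : A → X} (hi : Topology.IsOpenEmbedding i) (a : A) (e : E)
    (he : f e = i a) :
    ∃ s : X → E, ContinuousOn s (Set.range i) ∧ (∀ x ∈ Set.range i, f (s x) = x) ∧
      s (i a) = e := by
  obtain ⟨G, ⟨hG, hfG⟩, -⟩ := hf.existsUnique_continuousMap_lifts ⟨i, hi.continuous⟩ a e he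
  have : Nonempty A := ⟨a⟩
  have hinv : ∀ x, Function.invFun i (i x) = x := Function.leftInverse_invFun hi.injective
  refine ⟨G ∘ Function.invFun i, ?_, ?_, ?_⟩
  · rintro _ ⟨x, rfl⟩
    apply ContinuousAt.continuousWithinAt
    rw [← hi.continuousAt_iff]
    have : (G ∘ Function.invFun i) ∘ i = G := by
      ext x
      simp [hinv]
    rw [this]
    exact G.continuous.continuousAt
  · rintro _ ⟨x, rfl⟩
    simpa [hinv] using congrFun hfG x
  · simp [hinv, hG]

end Sections

/-! ### Slit planes, half strips and the exponential. -/

section Plane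

theorem isPreconnected_re_strip (a b : ℝ) : IsPreconnected {z : ℍ | a < z.re ∧ z.re < b} := by
  rw [← UpperHalfPlane.isEmbedding_coe.isInducing.isPreconnected_image]
  have : ((↑) : ℍ → ℂ) '' {z : ℍ | a < z.re ∧ z.re < b} =
      {w : ℂ | 0 < w.im} ∩ ({w : ℂ | a < w.re} ∩ {w : ℂ | w.re < b}) := by
    ext w
    constructor
    · rintro ⟨z, ⟨h1, h2⟩, rfl⟩
      exact ⟨z.im_pos, h1, h2⟩
    · rintro ⟨h, h1, h2⟩
      exact ⟨⟨w, h⟩, ⟨h1, h2⟩, rfl⟩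
  rw [this]
  exact ((convex_halfSpace_im_gt 0).inter
    ((convex_halfSpace_re_gt a).inter (convex_halfSpace_re_lt b))).isPreconnected

/-- The plane with the horizontal rays to the left of the points `b j` removed. -/
def slitPlane' {J : Type*} (b : J → ℂ) : Set ℂ :=
  {w | ∀ j, w.im = (b j).im → (b j).re < w.re}

variable {J : Type*} [Finite J] (b : J → ℂ)

theorem isOpen_slitPlane' : IsOpen (slitPlane' b) := by
  have : slitPlane' b = ⋂ j, ({w : ℂ | w.im = (b j).im} ∩ {w | w.re ≤ (b j).re})ᶜ := by
    ext w
    simp [slitPlane']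
  rw [this]
  refine isOpen_iInter_of_finite fun j => IsClosed.isOpen_compl (self := ?_)
  exact (isClosed_eq Complex.continuous_im continuous_const).inter
    (isClosed_le Complex.continuous_re continuous_const)

theorem exists_re_lt : ∃ A : ℝ, 0 ≤ A ∧ ∀ j, (b j).re < A := by
  obtain ⟨A, hA⟩ := (Set.finite_range fun j => (b j).re).bddAbove
  refine ⟨max A 0 + 1, by positivity, fun j => ?_⟩
  have := hA ⟨j, rfl⟩
  have := le_max_left A 0
  simp only at *
  linarith

/-- Moving points to the right never meets a slit. A horizontal translation by `|re w| + A` brings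
everything into the half plane `A ≤ re w`, which is then contracted linearly to `A`. -/
theorem contractibleSpace_slitPlane' : ContractibleSpace (slitPlane' b) := by
  obtain ⟨A, hA0, hA⟩ := exists_re_lt b
  rw [contractible_iff_id_nullhomotopic]
  have hfar : ∀ w : ℂ, A ≤ w.re → w ∈ slitPlane' b := fun w hw j _ => (hA j).trans_le hw
  let φ : C(slitPlane' b, slitPlane' b) :=
    ⟨fun w => ⟨(w : ℂ) + ((|(w : ℂ).re| + A : ℝ) : ℂ), hfar _ (by
      have := neg_abs_le (w : ℂ).re
      simp only [Complex.add_re, Complex.ofReal_re]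
      linarith)⟩, by fun_prop⟩
  have h1 : (ContinuousMap.id (slitPlane' b)).Homotopic φ := by
    refine ⟨⟨⟨fun p => ⟨(p.2 : ℂ) + (((p.1 : ℝ) * (|(p.2 : ℂ).re| + A) : ℝ) : ℂ), ?_⟩, ?_⟩, ?_, ?_⟩⟩
    · intro j hj
      have hp := p.2.2 j (by simpa using hj)
      have h0 : 0 ≤ (p.1 : ℝ) * (|(p.2 : ℂ).re| + A) :=
        mul_nonneg p.1.2.1 (add_nonneg (abs_nonneg _) hA0)
      simp only [Complex.add_re, Complex.ofReal_re]
      linarith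
    · fun_prop
    · intro w
      ext
      simp
    · intro w
      ext
      simp [φ]
  have h2 : φ.Homotopic (ContinuousMap.const _ ⟨(A : ℂ), hfar _ (by simp)⟩) := by
    refine ⟨⟨⟨fun p => ⟨((1 - (p.1 : ℝ) : ℝ) : ℂ) * ((p.2 : ℂ) + ((|(p.2 : ℂ).re| : ℝ) : ℂ)) + A,
      hfar _ ?_⟩, ?_⟩, ?_, ?_⟩⟩
    · have h0 : 0 ≤ (1 - (p.1 : ℝ)) * ((p.2 : ℂ).re + |(p.2 : ℂ).re|) :=
        mul_nonneg (by linarith [p.1.2.2]) (by linarith [neg_abs_le (p.2 : ℂ).re])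
      rw [Complex.add_re, Complex.re_ofReal_mul, Complex.add_re, Complex.ofReal_re,
        Complex.ofReal_re]
      linarith
    · fun_prop
    · intro w
      ext
      simp [φ, add_assoc]
    · intro w
      ext
      simp
  exact ⟨_, h1.trans h2⟩

/-- The half strip of half width `ε` around the horizontal ray to the left of `c`. -/
def leftHalfStrip (ε : ℝ) (c : ℂ) : Set ℂ :=
  {w | w.re < c.re ∧ |w.im - c.im| < ε}

theorem isOpen_leftHalfStrip (ε : ℝ) (c : ℂ) : IsOpen (leftHalfStrip ε c) :=
  (isOpen_lt Complex.continuous_re continuous_const).inter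
    (isOpen_lt ((Complex.continuous_im.sub continuous_const).abs) continuous_const)

theorem convex_leftHalfStrip (ε : ℝ) (c : ℂ) : Convex ℝ (leftHalfStrip ε c) := by
  have : leftHalfStrip ε c =
      {w : ℂ | w.re < c.re} ∩ ({w | c.im - ε < w.im} ∩ {w | w.im < c.im + ε}) := by
    ext w
    simp only [leftHalfStrip, abs_lt, Set.mem_inter_iff, Set.mem_ofPred_eq]
    constructor <;> rintro ⟨h1, h2, h3⟩ <;> exact ⟨h1, by linarith, by linarith⟩
  rw [this]
  exact (convex_halfSpace_re_lt _).inter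
    ((convex_halfSpace_im_gt _).inter (convex_halfSpace_im_lt _))

/-- The factor 2 makes the strips of half width `ε` around different rays disjoint. -/
theorem exists_im_separation {b : J → ℂ} (hb : Function.Injective fun j => (b j).im) :
    ∃ ε : ℝ, 0 < ε ∧ ∀ i j, i ≠ j → 2 * ε < |(b i).im - (b j).im| := by
  have h : ∀ᶠ ε : ℝ in 𝓝[>] 0, ∀ p : J × J, p.1 ≠ p.2 → 2 * ε < |(b p.1).im - (b p.2).im| := by
    rw [Filter.eventually_all]
    intro p
    by_cases hp : p.1 = p.2
    · simp [hp]
    · have hpos : 0 < |(b p.1).im - (b p.2).im| := abs_pos.2 (sub_ne_zero.2 fun h => hp (hb h))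
      have hc : Filter.Tendsto (fun ε : ℝ => 2 * ε) (𝓝[>] 0) (𝓝 0) := by
        have : Continuous fun ε : ℝ => 2 * ε := by fun_prop
        simpa using (this.tendsto 0).mono_left nhdsWithin_le_nhds
      filter_upwards [hc.eventually (gt_mem_nhds hpos)] with ε h _ using h
  obtain ⟨ε, h, h0⟩ := (h.and self_mem_nhdsWithin).exists
  exact ⟨ε, h0, fun i j => h (i, j)⟩

theorem exp_two_pi_I_re (z : ℍ) : (Complex.exp (2 * Real.pi * Complex.I * z)).re =
    Real.exp (-(2 * Real.pi * z.im)) * Real.cos (2 * Real.pi * z.re) := by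
  rw [Complex.exp_re]
  simp

theorem exp_two_pi_I_im (z : ℍ) : (Complex.exp (2 * Real.pi * Complex.I * z)).im =
    Real.exp (-(2 * Real.pi * z.im)) * Real.sin (2 * Real.pi * z.re) := by
  rw [Complex.exp_im]
  simp

theorem exp_two_pi_I_add_one (z : ℍ) :
    Complex.exp (2 * Real.pi * Complex.I * (((1 : ℝ) +ᵥ z : ℍ) : ℂ)) =
      Complex.exp (2 * Real.pi * Complex.I * z) := by
  rw [UpperHalfPlane.coe_vadd, Complex.ofReal_one, mul_add, mul_one, Complex.exp_add,
    Complex.exp_two_pi_mul_I, one_mul]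

end Plane

/-! ### Free generators for the punctured plane. -/

section PuncturedPlane

variable {E J : Type*} [Finite J] [TopologicalSpace E] [SimplyConnectedSpace E]
  [LocallyPathConnectedSpace E]

/-- The inclusion of a subset of the punctured plane is an open embedding. -/
theorem isOpenEmbedding_inclusion_puncturedPlane {b : J → ℂ} {S : Set ℂ} (hS : IsOpen S)
    (hSb : ∀ w ∈ S, ∀ j, w ≠ b j) :
    Topology.IsOpenEmbedding fun w : S => (⟨w, hSb w w.2⟩ : {w : ℂ // ∀ j, w ≠ b j}) := by
  have hX : IsOpen {w : ℂ | ∀ j, w ≠ b j} := by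
    have : {w : ℂ | ∀ j, w ≠ b j} = ⋂ j, {b j}ᶜ := by
      ext w
      simp
    rw [this]
    exact isOpen_iInter_of_finite fun j => isOpen_compl_singleton
  exact Topology.IsOpenEmbedding.of_comp _ hX.isOpenEmbedding_subtypeVal
    hS.isOpenEmbedding_subtypeVal

theorem range_inclusion_puncturedPlane {b : J → ℂ} {S : Set ℂ} (hSb : ∀ w ∈ S, ∀ j, w ≠ b j) :
    Set.range (fun w : S => (⟨w, hSb w w.2⟩ : {w : ℂ // ∀ j, w ≠ b j})) =
      {x : {w : ℂ // ∀ j, w ≠ b j} | (x : ℂ) ∈ S} := by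
  ext x
  constructor
  · rintro ⟨w, rfl⟩
    exact w.2
  · exact fun hx => ⟨⟨x, hx⟩, rfl⟩

/-- The deck transformation group of a simply connected covering of a punctured plane is free on
transformations given by the monodromy of small positive circles around the punctures. -/
theorem exists_freeGroupBasis_puncturedPlane {b : J → ℂ}
    (hb : Function.Injective fun j => (b j).im) {f : E → {w : ℂ // ∀ j, w ≠ b j}}
    (hf : IsCoveringMap f) (hsurj : Function.Surjective f) :
    ∃ B : FreeGroupBasis J (deckGroup f), ∀ j, ∃ r : ℝ, 0 < r ∧ ∃ g : ℍ → E, Continuous g ∧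
      (∀ z : ℍ, (f (g z) : ℂ) = b j + r * Complex.exp (2 * Real.pi * Complex.I * z)) ∧
      ∀ z : ℍ, g ((1 : ℝ) +ᵥ z) = (B j : E ≃ₜ E) (g z) := by
  obtain ⟨ε, hε, hsep⟩ := exists_im_separation hb
  have hSU : ∀ w ∈ slitPlane' b, ∀ j, w ≠ b j := by
    rintro w hw j rfl
    exact lt_irrefl _ (hw j rfl)
  have hSO : ∀ j, ∀ w ∈ leftHalfStrip ε (b j), ∀ i, w ≠ b i := by
    rintro j w ⟨h1, h2⟩ i rfl
    by_cases hij : i = j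
    · exact lt_irrefl _ (hij ▸ h1)
    · linarith [hsep i j hij]
  have him : ∀ j i, i ≠ j → ∀ w : ℂ, |w.im - (b j).im| < ε → w.im ≠ (b i).im := by
    intro j i hij w hw he
    rw [he] at hw
    linarith [hsep i j hij]
  obtain ⟨A, hA0, hA⟩ := exists_re_lt b
  let X := {w : ℂ // ∀ j, w ≠ b j}
  let U : Set X := {x | (x : ℂ) ∈ slitPlane' b}
  let O : J → Set X := fun j => {x | (x : ℂ) ∈ leftHalfStrip ε (b j)}
  let P : J → Set X := fun j => {x | (x : ℂ) ∈ leftHalfStrip ε (b j) ∧ (b j).im < (x : ℂ).im}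
  let N : J → Set X := fun j => {x | (x : ℂ) ∈ leftHalfStrip ε (b j) ∧ (x : ℂ).im < (b j).im}
  have hval : Continuous (Subtype.val : X → ℂ) := continuous_subtype_val
  have hUo : IsOpen U := (isOpen_slitPlane' b).preimage hval
  have hOo : ∀ j, IsOpen (O j) := fun j => (isOpen_leftHalfStrip ε (b j)).preimage hval
  have hPo : ∀ j, IsOpen (P j) := fun j => (hOo j).inter
    (isOpen_lt continuous_const (Complex.continuous_im.comp hval))
  have hNo : ∀ j, IsOpen (N j) := fun j => (hOo j).inter
    (isOpen_lt (Complex.continuous_im.comp hval) continuous_const)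
  have hiU := isOpenEmbedding_inclusion_puncturedPlane (isOpen_slitPlane' b) hSU
  have hrU : Set.range (fun w : slitPlane' b => (⟨w, hSU w w.2⟩ : X)) = U :=
    range_inclusion_puncturedPlane hSU
  have hiO := fun j => isOpenEmbedding_inclusion_puncturedPlane
    (isOpen_leftHalfStrip ε (b j)) (hSO j)
  have hrO : ∀ j, Set.range (fun w : leftHalfStrip ε (b j) => (⟨w, hSO j w w.2⟩ : X)) = O j :=
    fun j => range_inclusion_puncturedPlane (hSO j)
  have := contractibleSpace_slitPlane' b
  have : LocallyPathConnectedSpace (slitPlane' b) := (isOpen_slitPlane' b).locallyPathConnectedSpace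
  have : ∀ j, LocallyPathConnectedSpace (leftHalfStrip ε (b j)) := fun j =>
    (isOpen_leftHalfStrip ε (b j)).locallyPathConnectedSpace
  have hUc : IsPreconnected U := hrU ▸ isPreconnected_range hiU.continuous
  have hpt : ∀ j, ∀ y : ℝ, |y| < 1 → (b j) + (-ε : ℝ) + (ε * y : ℝ) * Complex.I ∈
      leftHalfStrip ε (b j) := by
    intro j y hy
    constructor
    · simp [hε]
    · simp only [Complex.add_im, Complex.ofReal_im, Complex.im_ofReal_mul, Complex.I_im]
      rw [show (b j).im + 0 + ε * y * 1 - (b j).im = ε * y by ring, abs_mul, abs_of_pos hε]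
      exact mul_lt_of_lt_one_right hε hy
  have : ∀ j, ContractibleSpace (leftHalfStrip ε (b j)) := fun j =>
    (convex_leftHalfStrip ε (b j)).contractibleSpace ⟨_, hpt j 0 (by simp)⟩
  have hOc : ∀ j, IsPreconnected (O j) := fun j => hrO j ▸ isPreconnected_range (hiO j).continuous
  have hcov : ∀ x, x ∈ U ∨ ∃ j, x ∈ O j := by
    intro x
    by_contra! h
    obtain ⟨h1, h2⟩ := h
    apply h1
    intro j hj
    by_contra! hre
    refine h2 j ⟨lt_of_le_of_ne hre fun he => x.2 j (Complex.ext he hj), ?_⟩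
    rw [hj]
    simpa using hε
  have hdisj : ∀ i j, i ≠ j → Disjoint (O i) (O j) := by
    intro i j hij
    rw [Set.disjoint_left]
    rintro x ⟨-, h1⟩ ⟨-, h2⟩
    have := abs_sub_le (b i).im (x : ℂ).im (b j).im
    rw [abs_sub_comm] at h1
    linarith [hsep i j hij]
  have hUO : ∀ j, U ∩ O j = P j ∪ N j := by
    intro j
    ext x
    constructor
    · rintro ⟨hU, hO⟩
      rcases lt_trichotomy (x : ℂ).im (b j).im with h | h | h
      · exact Or.inr ⟨hO, h⟩
      · exact absurd (hU j h) (not_lt.2 hO.1.le)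
      · exact Or.inl ⟨hO, h⟩
    · have key : x ∈ O j → (x : ℂ).im ≠ (b j).im → x ∈ U ∩ O j := by
        refine fun hO hne => ⟨fun i hi => ?_, hO⟩
        by_cases hij : i = j
        · exact absurd (hij ▸ hi) hne
        · exact absurd hi (him j i hij _ hO.2)
      rintro (⟨hO, h⟩ | ⟨hO, h⟩)
      exacts [key hO h.ne', key hO h.ne]
  have hPN : ∀ j, Disjoint (P j) (N j) := fun j =>
    Set.disjoint_left.2 fun x h1 h2 => lt_asymm h1.2 h2.2
  have hUne : U.Nonempty :=
    have hA' : (A : ℂ) ∈ slitPlane' b := fun j _ => by simpa using hA j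
    ⟨⟨A, hSU _ hA'⟩, hA'⟩
  have hPne : ∀ j, (P j).Nonempty := fun j =>
    have h := hpt j (1 / 2) (by norm_num [abs_lt])
    ⟨⟨_, hSO j _ h⟩, h, by simp [hε]⟩
  have hNne : ∀ j, (N j).Nonempty := fun j =>
    have h := hpt j (-1 / 2) (by norm_num [abs_lt])
    ⟨⟨_, hSO j _ h⟩, h, by simpa using by linarith⟩
  obtain ⟨u0, hu0⟩ := hUne
  obtain ⟨e0, he0⟩ := hsurj u0
  obtain ⟨s, hs, hfs, -⟩ := hf.exists_section hiU ⟨u0, hu0⟩ e0 he0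
  rw [hrU] at hs hfs
  have hPU : ∀ j, P j ⊆ U := fun j x hx => ((hUO j).symm ▸ Or.inl hx : x ∈ U ∩ O j).1
  have hNU : ∀ j, N j ⊆ U := fun j x hx => ((hUO j).symm ▸ Or.inr hx : x ∈ U ∩ O j).1
  have hPO : ∀ j, P j ⊆ O j := fun j x hx => hx.1
  have hNO : ∀ j, N j ⊆ O j := fun j x hx => hx.1
  choose p hp using hPne
  choose q hq using hNne
  -- The section over the strip is normalized to agree with `s` above the cut; its discrepancy with
  -- `s` below the cut then defines `γ j`.
  have hsec := fun j => hf.exists_section (hiO j) ⟨p j, (hp j).1⟩ (s (p j)) (hfs _ (hPU j (hp j)))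
  choose t ht hft htp using hsec
  have ht : ∀ j, ContinuousOn (t j) (O j) := fun j => (hrO j) ▸ ht j
  have hft : ∀ j, ∀ x ∈ O j, f (t j x) = x := fun j x hx => hft j x ((hrO j).symm ▸ hx)
  have hγ : ∀ j, ∃ γ : deckGroup f, (γ : E ≃ₜ E) (s (q j)) = t j (q j) := fun j =>
    exists_deckGroup_apply_eq hf (by rw [hfs _ (hNU j (hq j)), hft j _ (hNO j (hq j))])
  choose γ hγ using hγ
  have hconv : ∀ (S : Set ℂ) (hS : Convex ℝ S) (hSX : ∀ w ∈ S, ∀ j, w ≠ b j),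
      IsPreconnected {x : X | (x : ℂ) ∈ S} := by
    intro S hS hSX
    rw [← range_inclusion_puncturedPlane hSX]
    have : PreconnectedSpace S := Subtype.preconnectedSpace hS.isPreconnected
    exact isPreconnected_range (by fun_prop)
  have hPc : ∀ j, IsPreconnected (P j) := fun j =>
    hconv _ ((convex_leftHalfStrip ε (b j)).inter (convex_halfSpace_im_gt (b j).im))
      fun w hw => hSO j w hw.1
  have hNc : ∀ j, IsPreconnected (N j) := fun j =>
    hconv _ ((convex_leftHalfStrip ε (b j)).inter (convex_halfSpace_im_lt (b j).im))
      fun w hw => hSO j w hw.1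
  have htP : ∀ j, ∀ x ∈ P j, t j x = s x := fun j =>
    hf.eqOn_of_comp_eqOn (hPc j) ((ht j).mono (hPO j)) (hs.mono (hPU j))
      (fun x hx => by simp [hft j x (hPO j hx), hfs x (hPU j hx)]) (hp j) (htp j)
  have htN : ∀ j, ∀ x ∈ N j, t j x = (γ j : E ≃ₜ E) (s x) := fun j =>
    hf.eqOn_of_comp_eqOn (g₂ := fun x => (γ j : E ≃ₜ E) (s x)) (hNc j) ((ht j).mono (hNO j))
      ((γ j : E ≃ₜ E).continuous.comp_continuousOn (hs.mono (hNU j)))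
      (fun x hx => by simp [hft j x (hNO j hx), hfs x (hNU j hx), apply_deckGroup]) (hq j)
      (hγ j).symm
  obtain ⟨B, hB⟩ := exists_freeGroupBasis_of_cuts hf hUo hOo hPo hNo hUc hOc hcov hdisj hUO hPN
    (fun j => ⟨p j, hp j⟩) (fun j => ⟨q j, hq j⟩) ⟨u0, hu0⟩ hs hfs ht hft γ htP htN
  refine ⟨B, fun j => ⟨ε, hε, ?_⟩⟩
  have hnorm : ∀ z : ℍ, ‖(ε : ℂ) * Complex.exp (2 * Real.pi * Complex.I * z)‖ < ε := fun z => by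
    rw [norm_mul, Complex.norm_real, Real.norm_of_nonneg hε.le]
    exact mul_lt_of_lt_one_right hε (UpperHalfPlane.norm_exp_two_pi_I_lt_one z)
  let e : ℍ → ℂ := fun z => b j + ε * Complex.exp (2 * Real.pi * Complex.I * z)
  have here : ∀ z : ℍ, (e z).re = (b j).re +
      ε * (Real.exp (-(2 * Real.pi * z.im)) * Real.cos (2 * Real.pi * z.re)) := fun z => by
    simp only [e, Complex.add_re, Complex.re_ofReal_mul, exp_two_pi_I_re]
  have heim : ∀ z : ℍ, (e z).im = (b j).im +
      ε * (Real.exp (-(2 * Real.pi * z.im)) * Real.sin (2 * Real.pi * z.re)) := fun z => by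
    simp only [e, Complex.add_im, Complex.im_ofReal_mul, exp_two_pi_I_im]
  have heε : ∀ z, |(e z).im - (b j).im| < ε := fun z => by
    have := (Complex.abs_im_le_norm _).trans_lt (hnorm z)
    simpa [e] using this
  have heX : ∀ z i, e z ≠ b i := by
    intro z i h
    by_cases hij : i = j
    · subst hij
      have : (ε : ℂ) * Complex.exp (2 * Real.pi * Complex.I * z) ≠ 0 :=
        mul_ne_zero (by exact_mod_cast hε.ne') (Complex.exp_ne_zero _)
      exact this (by simpa [e] using h)
    · exact him j i hij _ (heε z) (by rw [h])
  let eX : ℍ → X := fun z => ⟨e z, heX z⟩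
  have heXc : Continuous eX := by
    have := UpperHalfPlane.continuous_coe
    fun_prop
  have heU : ∀ z : ℍ, -(1 / 2) < z.re → z.re < 1 / 2 → eX z ∈ U := by
    intro z h1 h2 i hi
    by_cases hij : i = j
    · subst hij
      change (e z).im = _ at hi
      change _ < (e z).re
      have hpos := Real.exp_pos (-(2 * Real.pi * z.im))
      have hs0 : Real.sin (2 * Real.pi * z.re) = 0 := by
        rw [heim] at hi
        have : ε * (Real.exp (-(2 * Real.pi * z.im)) * Real.sin (2 * Real.pi * z.re)) = 0 := by
          linarith
        simpa [hε.ne', hpos.ne'] using this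
      have hx0 := (Real.sin_eq_zero_iff_of_lt_of_lt (x := 2 * Real.pi * z.re)
        (by nlinarith [Real.pi_pos]) (by nlinarith [Real.pi_pos])).1 hs0
      rw [here, hx0, Real.cos_zero]
      have : 0 < ε * (Real.exp (-(2 * Real.pi * z.im)) * 1) := by positivity
      linarith
    · exact absurd hi (him j i hij _ (heε z))
  have heO : ∀ z : ℍ, 1 / 4 < z.re → z.re < 3 / 4 → eX z ∈ O j := by
    intro z h1 h2
    refine ⟨?_, heε z⟩
    change (e z).re < _
    rw [here]
    have hc : Real.cos (2 * Real.pi * z.re) < 0 :=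
      Real.cos_neg_of_pi_div_two_lt_of_lt (by nlinarith [Real.pi_pos]) (by nlinarith [Real.pi_pos])
    have := mul_neg_of_pos_of_neg hε
      (mul_neg_of_pos_of_neg (Real.exp_pos (-(2 * Real.pi * z.im))) hc)
    linarith
  have hperiod : ∀ z : ℍ, eX ((1 : ℝ) +ᵥ z) = eX z := fun z => by
    apply Subtype.ext
    simp only [eX, e, exp_two_pi_I_add_one]
  have heU' : ∀ z : ℍ, 1 / 2 < z.re → z.re < 3 / 2 → eX z ∈ U := by
    intro z h1 h2
    rw [← hperiod]
    have : (1 : ℝ) +ᵥ ((-1 : ℝ) +ᵥ z) = z := by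
      rw [vadd_vadd]
      norm_num
    rw [← this, hperiod, hperiod]
    apply heU <;> rw [UpperHalfPlane.vadd_re] <;> linarith
  let pt : ℝ → ℍ := fun x => ⟨x + Complex.I, by simp⟩
  have hpt : ∀ x, (pt x).re = x := fun x => by simp [pt, UpperHalfPlane.re]
  -- As `re z` grows from 0 to 1 the lift equals `s`, then `t j`, then `γ j` applied to `s`. The
  -- changes are compared at real parts 3/8 and 5/8, where the sign of the sine puts the circle
  -- above, respectively below, the cut.
  obtain ⟨G, ⟨hG, hfG⟩, -⟩ := hf.existsUnique_continuousMap_lifts ⟨eX, heXc⟩ (pt 0) (s (eX (pt 0)))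
    (hfs _ (heU _ (by rw [hpt]; norm_num) (by rw [hpt]; norm_num)))
  have hfG : ∀ z, f (G z) = eX z := congrFun hfG
  have hGA : Set.EqOn G (s ∘ eX) {z : ℍ | -(1 / 2) < z.re ∧ z.re < 1 / 2} := by
    refine hf.eqOn_of_comp_eqOn (isPreconnected_re_strip _ _) G.continuous.continuousOn
      (hs.comp heXc.continuousOn fun z hz => heU z hz.1 hz.2) (fun z hz => ?_) (a := pt 0)
      (by rw [Set.mem_ofPred_eq, hpt]; norm_num) hG
    simp [hfG, hfs _ (heU z hz.1 hz.2)]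
  have hGB : Set.EqOn G (t j ∘ eX) {z : ℍ | 1 / 4 < z.re ∧ z.re < 3 / 4} := by
    refine hf.eqOn_of_comp_eqOn (isPreconnected_re_strip _ _) G.continuous.continuousOn
      ((ht j).comp heXc.continuousOn fun z hz => heO z hz.1 hz.2) (fun z hz => ?_) (a := pt (3 / 8))
      (by rw [Set.mem_ofPred_eq, hpt]; norm_num) ?_
    · simp [hfG, hft j _ (heO z hz.1 hz.2)]
    · rw [hGA (by rw [Set.mem_ofPred_eq, hpt]; norm_num)]
      refine (htP j _ ⟨heO _ (by rw [hpt]; norm_num) (by rw [hpt]; norm_num), ?_⟩).symm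
      change _ < (e _).im
      rw [heim, hpt]
      have : 0 < Real.sin (2 * Real.pi * (3 / 8)) :=
        Real.sin_pos_of_pos_of_lt_pi (by positivity) (by nlinarith [Real.pi_pos])
      have : 0 < ε * (Real.exp (-(2 * Real.pi * (pt (3 / 8)).im)) *
        Real.sin (2 * Real.pi * (3 / 8))) := by positivity
      linarith
  have hGC : Set.EqOn G ((γ j : E ≃ₜ E) ∘ s ∘ eX) {z : ℍ | 1 / 2 < z.re ∧ z.re < 3 / 2} := by
    refine hf.eqOn_of_comp_eqOn (isPreconnected_re_strip _ _) G.continuous.continuousOn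
      ((γ j : E ≃ₜ E).continuous.comp_continuousOn
        (hs.comp heXc.continuousOn fun z hz => heU' z hz.1 hz.2)) (fun z hz => ?_)
      (a := pt (5 / 8)) (by rw [Set.mem_ofPred_eq, hpt]; norm_num) ?_
    · simp [hfG, apply_deckGroup, hfs _ (heU' z hz.1 hz.2)]
    · rw [hGB (by rw [Set.mem_ofPred_eq, hpt]; norm_num)]
      refine htN j _ ⟨heO _ (by rw [hpt]; norm_num) (by rw [hpt]; norm_num), ?_⟩
      change (e _).im < _
      rw [heim, hpt]
      have : Real.sin (2 * Real.pi * (5 / 8)) < 0 := by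
        rw [show 2 * Real.pi * (5 / 8) = Real.pi / 4 + Real.pi by ring, Real.sin_add_pi]
        exact neg_neg_of_pos
          (Real.sin_pos_of_pos_of_lt_pi (by positivity) (by nlinarith [Real.pi_pos]))
      have := mul_neg_of_pos_of_neg hε
        (mul_neg_of_pos_of_neg (Real.exp_pos (-(2 * Real.pi * (pt (5 / 8)).im))) this)
      linarith
  refine ⟨G, G.continuous, fun z => by rw [hfG], ?_⟩
  have hpt1 : (1 : ℝ) +ᵥ pt 0 = pt 1 := by
    ext
    simp [pt]
  have := hf.eq_of_comp_eq (g₁ := fun z => G ((1 : ℝ) +ᵥ z)) (g₂ := fun z => (B j : E ≃ₜ E) (G z))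
    (G.continuous.comp (UpperHalfPlane.isometry_real_vadd 1).continuous)
    ((B j : E ≃ₜ E).continuous.comp G.continuous)
    (by ext z : 1; simp only [Function.comp, apply_deckGroup, hfG, hperiod]) (pt 0) (by
      simp only [hpt1]
      rw [hGC (by rw [Set.mem_ofPred_eq, hpt]; norm_num),
        hGA (by rw [Set.mem_ofPred_eq, hpt]; norm_num), hB]
      simp only [Function.comp]
      rw [← hpt1, hperiod])
  exact congrFun this

end PuncturedPlane

/-! ### Affine coordinates on the Riemann sphere. -/

section SphereCoordinate

/-- The standard affine coordinate on the complement of the point `p` of the Riemann sphere: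
`x` if `p = ∞` and `1 / (x - p)` otherwise. -/
noncomputable def awayCoord : OnePoint ℂ → OnePoint ℂ → ℂ
  -- At `x = p` both branches give the meaningless value 0 (in the second one as `0⁻¹`), whereas the
  -- value 0 at `∞` for finite `p` is the true one.
  | none, x => x.elim 0 id
  | some c, x => x.elim 0 fun z => (z - c)⁻¹

/-- The inverse of `awayCoord p`. -/
noncomputable def awayParam : OnePoint ℂ → ℂ → OnePoint ℂ
  | none, w => (w : OnePoint ℂ)
  | some c, w => if w = 0 then OnePoint.infty else ((c + w⁻¹ : ℂ) : OnePoint ℂ)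

@[simp] theorem awayCoord_infty_coe (z : ℂ) : awayCoord OnePoint.infty (z : OnePoint ℂ) = z := rfl

@[simp] theorem awayCoord_coe_coe (c z : ℂ) :
    awayCoord (c : OnePoint ℂ) (z : OnePoint ℂ) = (z - c)⁻¹ := rfl

@[simp] theorem awayCoord_coe_infty (c : ℂ) : awayCoord (c : OnePoint ℂ) OnePoint.infty = 0 := rfl

@[simp] theorem awayParam_infty (w : ℂ) : awayParam OnePoint.infty w = (w : OnePoint ℂ) := rfl

theorem awayParam_coe (c w : ℂ) : awayParam (c : OnePoint ℂ) w =
    if w = 0 then OnePoint.infty else ((c + w⁻¹ : ℂ) : OnePoint ℂ) := rfl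

theorem sphereParam_coe (c w : ℂ) : sphereParam (c : OnePoint ℂ) w = ((c + w : ℂ) : OnePoint ℂ) :=
  rfl

theorem sphereParam_infty (w : ℂ) : sphereParam OnePoint.infty w =
    if w = 0 then OnePoint.infty else ((w⁻¹ : ℂ) : OnePoint ℂ) := rfl

theorem awayParam_awayCoord {p x : OnePoint ℂ} (h : x ≠ p) : awayParam p (awayCoord p x) = x := by
  induction p using OnePoint.rec with
  | infty =>
    induction x using OnePoint.rec with
    | infty => exact absurd rfl h
    | coe z => simp
  | coe c =>
    induction x using OnePoint.rec with
    | infty => simp [awayParam_coe]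
    | coe z =>
      have : z - c ≠ 0 := sub_ne_zero.2 fun e => h (e ▸ rfl)
      simp [awayParam_coe, this]

theorem awayCoord_awayParam (p : OnePoint ℂ) (w : ℂ) : awayCoord p (awayParam p w) = w := by
  induction p using OnePoint.rec with
  | infty => simp
  | coe c =>
    rw [awayParam_coe]
    split_ifs with h
    · simp [h]
    · simp

theorem awayParam_ne (p : OnePoint ℂ) (w : ℂ) : awayParam p w ≠ p := by
  induction p using OnePoint.rec with
  | infty => simp
  | coe c =>
    rw [awayParam_coe]
    split_ifs with h
    · simp
    · simpa using h

theorem awayCoord_injOn (p : OnePoint ℂ) : Set.InjOn (awayCoord p) {p}ᶜ :=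
  Set.LeftInvOn.injOn (f₁' := awayParam p) fun _ hx => awayParam_awayCoord hx

theorem tendsto_cobounded_coe_infty :
    Filter.Tendsto ((↑) : ℂ → OnePoint ℂ) (Bornology.cobounded ℂ) (𝓝 OnePoint.infty) := by
  rw [Metric.cobounded_eq_cocompact, ← Filter.coclosedCompact_eq_cocompact]
  exact OnePoint.tendsto_coe_infty

theorem continuousAt_awayCoord {p x : OnePoint ℂ} (h : x ≠ p) : ContinuousAt (awayCoord p) x := by
  induction p using OnePoint.rec with
  | infty =>
    induction x using OnePoint.rec with
    | infty => exact absurd rfl h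
    | coe z =>
      rw [OnePoint.continuousAt_coe]
      exact continuousAt_id
  | coe c =>
    induction x using OnePoint.rec with
    | infty =>
      rw [OnePoint.continuousAt_infty', Filter.coclosedCompact_eq_cocompact,
        ← Metric.cobounded_eq_cocompact]
      exact Filter.tendsto_inv₀_cobounded.comp (tendsto_sub_const_cobounded c)
    | coe z =>
      have : z - c ≠ 0 := sub_ne_zero.2 fun e => h (e ▸ rfl)
      rw [OnePoint.continuousAt_coe]
      exact (continuousAt_id.sub continuousAt_const).inv₀ this

theorem continuous_awayParam (p : OnePoint ℂ) : Continuous (awayParam p) := by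
  induction p using OnePoint.rec with
  | infty => exact OnePoint.continuous_coe
  | coe c =>
    rw [continuous_iff_continuousAt]
    intro w
    by_cases hw : w = 0
    · subst hw
      rw [continuousAt_iff_punctured_nhds]
      have h1 : Filter.Tendsto (fun w : ℂ => ((c + w⁻¹ : ℂ) : OnePoint ℂ)) (𝓝[≠] 0)
          (𝓝 OnePoint.infty) :=
        tendsto_cobounded_coe_infty.comp
          ((tendsto_const_add_cobounded c).comp Filter.tendsto_inv₀_nhdsNE_zero)
      have h0 : awayParam (c : OnePoint ℂ) 0 = OnePoint.infty := by simp [awayParam_coe]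
      rw [h0]
      refine h1.congr' ?_
      filter_upwards [self_mem_nhdsWithin] with w hw
      exact (if_neg hw).symm
    · have h1 : ContinuousAt (fun w : ℂ => ((c + w⁻¹ : ℂ) : OnePoint ℂ)) w :=
        OnePoint.continuous_coe.continuousAt.comp
          (continuousAt_const.add (continuousAt_id.inv₀ hw))
      refine h1.congr ?_
      filter_upwards [isOpen_ne.mem_nhds hw] with w hw
      rw [awayParam_coe, if_neg hw]

theorem Continuous.sphereParam {A : Type*} [TopologicalSpace A] {h : A → ℂ} (hc : Continuous h)
    (h0 : ∀ x, h x ≠ 0) (p : OnePoint ℂ) : Continuous fun x => sphereParam p (h x) := by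
  induction p using OnePoint.rec with
  | infty =>
    simp only [sphereParam_infty, h0, if_false]
    exact OnePoint.continuous_coe.comp (hc.inv₀ h0)
  | coe c => exact OnePoint.continuous_coe.comp (continuous_const.add hc)

@[simp] theorem sphereParam_zero (p : OnePoint ℂ) : sphereParam p 0 = p := by
  induction p using OnePoint.rec with
  | infty => simp [sphereParam_infty]
  | coe c => simp [sphereParam_coe]

theorem sphereParam_injective (p : OnePoint ℂ) : Function.Injective (sphereParam p) := by
  intro v w h
  induction p using OnePoint.rec with
  | infty =>
    simp only [sphereParam_infty] at h
    split_ifs at h with h1 h2 h2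
    · rw [h1, h2]
    · exact absurd h (OnePoint.infty_ne_coe _)
    · exact absurd h (OnePoint.coe_ne_infty _)
    · simpa using h
  | coe c => simpa [sphereParam_coe] using h

/-- The change of coordinates from a standard disc around `q` to the affine coordinate on the
complement of `p`. -/
theorem exists_awayCoord_sphereParam {p q : OnePoint ℂ} (h : q ≠ p) :
    ∃ α β : ℂ, α ≠ 0 ∧ ∀ w : ℂ, α + β * w ≠ 0 → sphereParam q w ≠ p ∧
      awayCoord p (sphereParam q w) = awayCoord p q + w / (α + β * w) := by
  induction p using OnePoint.rec with
  | infty =>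
    induction q using OnePoint.rec with
    | infty => exact absurd rfl h
    | coe c => exact ⟨1, 0, one_ne_zero, fun w _ => by simp [sphereParam_coe]⟩
  | coe c =>
    induction q using OnePoint.rec with
    | infty =>
      refine ⟨1, -c, one_ne_zero, fun w hw => ?_⟩
      by_cases h0 : w = 0
      · simp [h0]
      · have h1 : w⁻¹ - c = (1 + -c * w) / w := by
          field_simp
          ring
        have h2 : w⁻¹ - c ≠ 0 := h1 ▸ div_ne_zero hw h0
        simp only [sphereParam_infty, if_neg h0, awayCoord_coe_coe, awayCoord_coe_infty, zero_add]
        exact ⟨fun e => h2 (sub_eq_zero.2 (OnePoint.coe_eq_coe.1 e)), by rw [h1, inv_div]⟩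
    | coe d =>
      have hdc : d - c ≠ 0 := sub_ne_zero.2 fun e => h (e ▸ rfl)
      refine ⟨-(d - c) ^ 2, -(d - c), neg_ne_zero.2 (pow_ne_zero 2 hdc), fun w hw => ?_⟩
      have h1 : -(d - c) ^ 2 + -(d - c) * w = -(d - c) * (d + w - c) := by ring
      have h2 : d + w - c ≠ 0 := fun e => hw (by rw [h1, e, mul_zero])
      refine ⟨fun e => h2 (sub_eq_zero.2 (OnePoint.coe_eq_coe.1 e)), ?_⟩
      rw [h1, sphereParam_coe, awayCoord_coe_coe, awayCoord_coe_coe]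
      field_simp
      ring

end SphereCoordinate

/-! ### Free generators for the punctured sphere. -/

section PuncturedSphere

/-- Multiplication by a suitable number makes the imaginary parts of finitely many distinct
complex numbers distinct. -/
theorem exists_mul_im_injective {J : Type*} [Finite J] {v : J → ℂ} (hv : Function.Injective v) :
    ∃ u : ℂ, u ≠ 0 ∧ Function.Injective fun j => (u * v j).im := by
  -- The expression is the imaginary part of a difference multiplied by `u = 1 + εi`.
  have h : ∀ᶠ ε : ℝ in 𝓝[>] 0, ∀ p : J × J, p.1 ≠ p.2 →
      (v p.1 - v p.2).im + ε * (v p.1 - v p.2).re ≠ 0 := by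
    rw [Filter.eventually_all]
    rintro ⟨i, j⟩
    by_cases hij : i = j
    · simp [hij]
    have hd : v i - v j ≠ 0 := sub_ne_zero.2 (hv.ne hij)
    by_cases him : (v i - v j).im = 0
    · have hre : (v i - v j).re ≠ 0 := fun hre => hd (Complex.ext hre him)
      filter_upwards [self_mem_nhdsWithin] with ε hε _
      rw [him, zero_add]
      exact mul_ne_zero (ne_of_gt hε) hre
    · have hc : Continuous fun ε : ℝ => (v i - v j).im + ε * (v i - v j).re := by fun_prop
      have := (hc.tendsto 0).eventually_ne (b₂ := 0) (by simpa using him)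
      filter_upwards [nhdsWithin_le_nhds this] with ε h _ using h
  obtain ⟨ε, h⟩ := h.exists
  refine ⟨⟨1, ε⟩, fun e => by simpa using congrArg Complex.re e, fun i j e => ?_⟩
  by_contra hij
  apply h (i, j) hij
  simp only [Complex.mul_im, Complex.sub_im, Complex.sub_re] at e ⊢
  linarith

/-- The affine coordinate identifies the sphere with `n` punctures with the plane with `n - 1`
punctures. -/
noncomputable def puncturedSphereHomeomorph {n : ℕ} (a : Fin n → OnePoint ℂ) (k : Fin n) {u : ℂ}
    (hu : u ≠ 0) :
    PuncturedSphere a ≃ₜ {w : ℂ // ∀ j : {j // a j ≠ a k}, w ≠ u * awayCoord (a k) (a j)} where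
  toFun x := ⟨u * awayCoord (a k) x, fun j e =>
    x.2 ⟨j, (awayCoord_injOn (a k) (fun h => x.2 ⟨k, h.symm⟩) j.2 (mul_left_cancel₀ hu e)).symm⟩⟩
  invFun w := ⟨awayParam (a k) (u⁻¹ * w), by
    rintro ⟨j, hj⟩
    by_cases hjk : a j = a k
    · exact awayParam_ne (a k) _ (hj ▸ hjk)
    · apply w.2 ⟨j, hjk⟩
      rw [hj, awayCoord_awayParam, mul_inv_cancel_left₀ hu]⟩
  left_inv x := by
    apply Subtype.ext
    simp only [inv_mul_cancel_left₀ hu]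
    exact awayParam_awayCoord fun h => x.2 ⟨k, h.symm⟩
  right_inv w := by
    apply Subtype.ext
    simp only [awayCoord_awayParam, mul_inv_cancel_left₀ hu]
  continuous_toFun := by
    refine Continuous.subtype_mk (continuous_const.mul (continuous_iff_continuousAt.2 fun x => ?_)) _
    exact (continuousAt_awayCoord fun h => x.2 ⟨k, h.symm⟩).comp continuous_subtype_val.continuousAt
  continuous_invFun :=
    ((continuous_awayParam (a k)).comp (continuous_const.mul continuous_subtype_val)).subtype_mk _

theorem deckGroup_comp_of_injective {E X Y : Type*} [TopologicalSpace E] {f : E → X} {φ : X → Y}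
    (hφ : Function.Injective φ) : deckGroup (φ ∘ f) = deckGroup f := by
  ext γ
  exact forall_congr' fun z => hφ.eq_iff

/-- A local change of the coordinate of a punctured disc lifts to the universal covering of a
smaller disc. -/
theorem exists_lift_coordinate_change {α : ℂ} (hα : α ≠ 0) (β : ℂ) {r : ℝ} (hr : 0 < r) :
    ∃ r' : ℝ, 0 < r' ∧ ∃ Φ : ℍ → ℍ, Continuous Φ ∧ (∀ z, Φ ((1 : ℝ) +ᵥ z) = (1 : ℝ) +ᵥ Φ z) ∧
      ∀ z : ℍ, α + β * (r' * Complex.exp (2 * Real.pi * Complex.I * z)) ≠ 0 ∧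
        (r : ℂ) * Complex.exp (2 * Real.pi * Complex.I * Φ z) =
          r' * Complex.exp (2 * Real.pi * Complex.I * z) /
            (α + β * (r' * Complex.exp (2 * Real.pi * Complex.I * z))) := by
  have hα' : 0 < ‖α‖ := norm_pos_iff.2 hα
  -- The first bound keeps the denominator at least `‖α‖ / 2` in norm; the second then keeps the
  -- quotient below `r`.
  obtain ⟨r', hr', h1, h2⟩ : ∃ r' : ℝ, 0 < r' ∧ ‖β‖ * r' ≤ ‖α‖ / 2 ∧ r' ≤ r * (‖α‖ / 2) := by
    refine ⟨min (‖α‖ / (2 * (‖β‖ + 1))) (r * (‖α‖ / 2)), by positivity, ?_, min_le_right _ _⟩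
    calc ‖β‖ * min (‖α‖ / (2 * (‖β‖ + 1))) (r * (‖α‖ / 2))
        ≤ (‖β‖ + 1) * (‖α‖ / (2 * (‖β‖ + 1))) := by
          gcongr
          · linarith
          · exact min_le_left _ _
      _ = ‖α‖ / 2 := by field_simp
  let w : ℍ → ℂ := fun z => r' * Complex.exp (2 * Real.pi * Complex.I * z)
  have hw : ∀ z, ‖w z‖ < r' := fun z => by
    simp only [w]
    rw [norm_mul, Complex.norm_real, Real.norm_of_nonneg hr'.le]
    exact mul_lt_of_lt_one_right hr' (UpperHalfPlane.norm_exp_two_pi_I_lt_one z)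
  have hwc : Continuous w := by
    have := UpperHalfPlane.continuous_coe
    fun_prop
  have hβw : ∀ z, ‖β * w z‖ ≤ ‖α‖ / 2 := fun z => by
    rw [norm_mul]
    exact (mul_le_mul_of_nonneg_left (hw z).le (norm_nonneg _)).trans h1
  have hden : ∀ z, ‖α‖ / 2 ≤ ‖α + β * w z‖ := fun z => by
    have := norm_sub_le (α + β * w z) (β * w z)
    rw [add_sub_cancel_right] at this
    linarith [hβw z]
  have hne : ∀ z, α + β * w z ≠ 0 := fun z => norm_pos_iff.1 ((half_pos hα').trans_le (hden z))
  have hslit : ∀ z, 1 + β * w z / α ∈ Complex.slitPlane := fun z => by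
    apply Complex.mem_slitPlane_of_norm_lt_one
    rw [norm_div, div_lt_one hα']
    linarith [hβw z]
  have hr0 : (r : ℂ) ≠ 0 := by exact_mod_cast hr.ne'
  have hr0' : (r' : ℂ) ≠ 0 := by exact_mod_cast hr'.ne'
  have hpi : (2 * Real.pi * Complex.I : ℂ) ≠ 0 := Complex.two_pi_I_ne_zero
  -- A logarithm of the coordinate change: since `1 + β * w z / α` stays in the slit plane and has
  -- period 1, `ψ z - z` is continuous with period 1.
  let ψ : ℍ → ℂ := fun z => z + (Complex.log (r' / (r * α)) - Complex.log (1 + β * w z / α)) /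
    (2 * Real.pi * Complex.I)
  have hψc : Continuous ψ := by
    refine UpperHalfPlane.continuous_coe.add (Continuous.div_const (continuous_const.sub ?_) _)
    exact Continuous.clog (by fun_prop) hslit
  have hexp : ∀ z, (r : ℂ) * Complex.exp (2 * Real.pi * Complex.I * ψ z) =
      w z / (α + β * w z) := by
    intro z
    have h1 : 2 * Real.pi * Complex.I * ψ z = 2 * Real.pi * Complex.I * z +
        (Complex.log (r' / (r * α)) - Complex.log (1 + β * w z / α)) := by
      simp only [ψ]
      rw [mul_add, mul_div_cancel₀ _ hpi]
    have h2 : 1 + β * w z / α ≠ 0 := Complex.slitPlane_ne_zero (hslit z)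
    have h3 : α + β * w z = α * (1 + β * w z / α) := by field_simp
    rw [h1, Complex.exp_add, Complex.exp_sub, Complex.exp_log (by positivity), Complex.exp_log h2,
      h3]
    simp only [w] at h2 ⊢
    field_simp
  have hψ : ∀ z, 0 < (ψ z).im := by
    intro z
    have h1 : ‖(r : ℂ) * Complex.exp (2 * Real.pi * Complex.I * ψ z)‖ < r := by
      rw [hexp, norm_div, div_lt_iff₀ (norm_pos_iff.2 (hne z))]
      calc ‖w z‖ < r' := hw z
        _ ≤ r * (‖α‖ / 2) := h2
        _ ≤ r * ‖α + β * w z‖ := by gcongr; exact hden z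
    rw [norm_mul, Complex.norm_real, Real.norm_of_nonneg hr.le, mul_lt_iff_lt_one_right hr,
      Complex.norm_exp, Real.exp_lt_one_iff] at h1
    simp at h1
    exact (mul_pos_iff_of_pos_left (by positivity : (0 : ℝ) < 2 * Real.pi)).1 h1
  refine ⟨r', hr', fun z => ⟨ψ z, hψ z⟩, hψc.upperHalfPlaneMk hψ, fun z => ?_,
    fun z => ⟨hne z, hexp z⟩⟩
  ext
  change ψ _ = ((1 : ℝ) : ℂ) + ψ z
  have : w ((1 : ℝ) +ᵥ z) = w z := by simp only [w, exp_two_pi_I_add_one]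
  simp only [ψ, this, UpperHalfPlane.coe_vadd, add_assoc]

variable {E : Type*} [TopologicalSpace E] [SimplyConnectedSpace E] [LocallyPathConnectedSpace E]

/-- The deck transformation group of a simply connected covering of the sphere with `n` punctures
is free on the monodromies of small positive circles around all punctures but one. -/
theorem exists_freeGroupBasis_puncturedSphere {n : ℕ} {a : Fin n → OnePoint ℂ}
    (ha : Function.Injective a) {f : E → PuncturedSphere a} (hf : IsCoveringMap f)
    (hsurj : Function.Surjective f) (k : Fin n) :
    ∃ B : FreeGroupBasis {j : Fin n // j ≠ k} (deckGroup f), ∀ j : {j : Fin n // j ≠ k},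
      ∃ r : ℝ, 0 < r ∧ ∃ g : ℍ → E, Continuous g ∧
      (∀ z : ℍ, (f (g z) : OnePoint ℂ) =
        sphereParam (a j) (r * Complex.exp (2 * Real.pi * Complex.I * z))) ∧
      ∀ z : ℍ, g ((1 : ℝ) +ᵥ z) = (B j : E ≃ₜ E) (g z) := by
  obtain ⟨u, hu, him⟩ := exists_mul_im_injective
    (v := fun j : {j // a j ≠ a k} => awayCoord (a k) (a j))
    fun i j h => Subtype.ext (ha (awayCoord_injOn (a k) i.2 j.2 h))
  let φ := puncturedSphereHomeomorph a k hu
  obtain ⟨B, hB⟩ := exists_freeGroupBasis_puncturedPlane him (hf.homeomorph_comp φ)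
    (φ.surjective.comp hsurj)
  let e : {j // a j ≠ a k} ≃ {j // j ≠ k} := Equiv.subtypeEquivRight fun j => ha.ne_iff
  refine ⟨(B.map (MulEquiv.subgroupCongr
    (deckGroup_comp_of_injective (f := f) φ.injective))).reindex e, fun j => ?_⟩
  have hjk : a j ≠ a k := ha.ne j.2
  obtain ⟨r, hr, g, hg, hfg, hgB⟩ := hB ⟨j, hjk⟩
  obtain ⟨α, β, hα, hαβ⟩ := exists_awayCoord_sphereParam hjk
  obtain ⟨r', hr', Φ, hΦ, hΦ1, hΦr⟩ := exists_lift_coordinate_change (div_ne_zero hα hu) (β / u) hr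
  -- The circle found in the scaled affine coordinate is replaced by one that is round in the
  -- standard coordinate at `a j`; `Φ` commutes with the unit translation, so the monodromy is
  -- unchanged.
  refine ⟨r', hr', g ∘ Φ, hg.comp hΦ, fun z => ?_, fun z => ?_⟩
  · obtain ⟨h1, h2⟩ := hΦr z
    have h3 : ∀ w : ℂ, α / u + β / u * w = (α + β * w) / u := fun w => by ring
    rw [h3] at h1 h2
    obtain ⟨h4, h5⟩ := hαβ _ fun h => h1 (by rw [h, zero_div])
    refine awayCoord_injOn (a k) (fun h => (f (g (Φ z))).2 ⟨k, h.symm⟩) h4 ?_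
    apply mul_left_cancel₀ hu
    refine (hfg (Φ z)).trans ?_
    rw [h2, h5]
    field_simp
  · simp only [Function.comp, hΦ1, hgB]
    rfl

end PuncturedSphere

/-! ### Holomorphy of continuous lifts. -/

section LocallyInjectiveFactor

/-- If `F` is analytic and locally injective, `h` is continuous and `F ∘ h` is analytic, then so is
`h`. -/
theorem analyticAt_of_comp_injOn {F h : ℂ → ℂ} {z₀ : ℂ} (hF : AnalyticAt ℂ F (h z₀))
    {W : Set ℂ} (hW : W ∈ 𝓝 (h z₀)) (hinj : Set.InjOn F W) (hh : ∀ᶠ z in 𝓝 z₀, ContinuousAt h z)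
    (hFh : AnalyticAt ℂ (fun z => F (h z)) z₀) : AnalyticAt ℂ h z₀ := by
  have hc : ContinuousAt h z₀ := hh.self_of_nhds
  have hW0 : h z₀ ∈ W := mem_of_mem_nhds hW
  rcases (hFh.sub analyticAt_const).eventually_eq_zero_or_eventually_ne_zero
    (f := fun z => F (h z) - F (h z₀)) with h0 | h0
  · have : h =ᶠ[𝓝 z₀] fun _ => h z₀ := by
      filter_upwards [h0, hc.eventually hW] with z hz hzW
      exact hinj hzW hW0 (sub_eq_zero.1 hz)
    exact analyticAt_const.congr this.symm
  have hne : ∀ᶠ z in 𝓝[≠] z₀, h z ∈ ({h z₀}ᶜ : Set ℂ) := by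
    filter_upwards [h0] with z hz he
    exact hz (by rw [Set.mem_singleton_iff.1 he, sub_self])
  have htend : Filter.Tendsto h (𝓝[≠] z₀) (𝓝[≠] (h z₀)) :=
    tendsto_nhdsWithin_iff.2 ⟨hc.mono_left nhdsWithin_le_nhds, hne⟩
  have hF' : ∀ᶠ w in 𝓝[≠] (h z₀), deriv F w ≠ 0 := by
    rcases hF.deriv.eventually_eq_zero_or_eventually_ne_zero with h1 | h1
    · exfalso
      obtain ⟨ε, hε, hball⟩ := Metric.eventually_nhds_iff_ball.1
        (h1.and (hF.eventually_analyticAt.and hW))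
      obtain ⟨w, hwball, hw⟩ : ∃ w ∈ Metric.ball (h z₀) ε, w ≠ h z₀ := by
        refine ⟨h z₀ + (ε / 2 : ℝ), ?_, ?_⟩
        · rw [Metric.mem_ball, dist_eq_norm, add_sub_cancel_left, Complex.norm_real,
            Real.norm_of_nonneg (by positivity)]
          linarith
        · simpa using hε.ne'
      have hconst := (convex_ball (h z₀) ε).is_const_of_fderivWithin_eq_zero (𝕜 := ℂ) (f := F)
        (fun x hx => (hball x hx).2.1.differentiableAt.differentiableWithinAt)
        (fun x hx => by
          rw [fderivWithin_of_isOpen Metric.isOpen_ball hx]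
          ext
          simpa using (hball x hx).1) hwball (Metric.mem_ball_self hε)
      exact hw (hinj (hball w hwball).2.2 hW0 hconst)
    · exact h1
  -- Off `z₀` the derivative of `F` does not vanish at `h z`, so a local inverse of `F` gives
  -- differentiability; the point `z₀` itself is a removable singularity.
  refine Complex.analyticAt_of_differentiable_on_punctured_nhds_of_continuousAt ?_ hc
  filter_upwards [htend.eventually hF', htend.eventually
    (nhdsWithin_le_nhds hF.eventually_analyticAt), nhdsWithin_le_nhds hh,
    nhdsWithin_le_nhds hFh.eventually_analyticAt] with z h1 h2 h3 h4
  let L := h2.hasStrictDerivAt.localInverse _ _ _ h1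
  have hL : ∀ᶠ z' in 𝓝 z, L (F (h z')) = h z' :=
    h3.eventually (h2.hasStrictDerivAt.eventually_left_inverse h1)
  have hLd : DifferentiableAt ℂ L (F (h z)) :=
    (h2.hasStrictDerivAt.to_localInverse h1).hasDerivAt.differentiableAt
  exact (DifferentiableAt.comp z hLd h4.differentiableAt).congr_of_eventuallyEq
    (hL.mono fun _ h => h.symm)

end LocallyInjectiveFactor

/-! ### The Schwarz-Pick lemma. -/

section SchwarzPick

open UpperHalfPlane ComplexConjugate

/-- Holomorphic functions on the upper half plane. -/
def HolomorphicOnUpperHalfPlane (g : ℍ → ℂ) : Prop :=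
  DifferentiableOn ℂ (fun w => g (ofComplex w)) {z | 0 < z.im}

theorem sub_conj_ne_zero (z w : ℍ) : (z : ℂ) - conj (w : ℂ) ≠ 0 := by
  intro h
  have := congrArg Complex.im h
  simp at this
  linarith [z.im_pos, w.im_pos]

theorem normSq_sub_conj (z w : ℍ) :
    ‖(z : ℂ) - conj (w : ℂ)‖ ^ 2 = ‖(z : ℂ) - w‖ ^ 2 + 4 * (z.im * w.im) := by
  rw [← Complex.normSq_eq_norm_sq, ← Complex.normSq_eq_norm_sq, Complex.normSq_apply,
    Complex.normSq_apply]
  simp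
  ring

/-- The Cayley transform of the upper half plane onto the unit disc which maps `w` to `0`. -/
noncomputable def cayley (w z : ℍ) : ℂ := ((z : ℂ) - w) / (z - conj (w : ℂ))

/-- The inverse of the Cayley transform. -/
noncomputable def invCayley (w : ℍ) (η : ℂ) : ℂ := (w - conj (w : ℂ) * η) / (1 - η)

theorem norm_cayley_lt_one (w z : ℍ) : ‖cayley w z‖ < 1 := by
  rw [cayley, norm_div, div_lt_one (norm_pos_iff.2 (sub_conj_ne_zero z w)),
    ← sq_lt_sq₀ (norm_nonneg _) (norm_nonneg _), normSq_sub_conj]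
  have := mul_pos z.im_pos w.im_pos
  linarith

@[simp] theorem cayley_self (w : ℍ) : cayley w w = 0 := by simp [cayley]

theorem one_sub_ne_zero_of_norm_lt_one {η : ℂ} (hη : ‖η‖ < 1) : 1 - η ≠ 0 := by
  intro h
  rw [← sub_eq_zero.1 h] at hη
  simp at hη

theorem invCayley_im_pos (w : ℍ) {η : ℂ} (hη : ‖η‖ < 1) : 0 < (invCayley w η).im := by
  have hne := one_sub_ne_zero_of_norm_lt_one hη
  have h1 : Complex.normSq η < 1 := by
    rw [Complex.normSq_eq_norm_sq]
    exact pow_lt_one₀ (norm_nonneg _) hη two_ne_zero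
  have : (invCayley w η).im = w.im * (1 - Complex.normSq η) / Complex.normSq (1 - η) := by
    rw [invCayley, Complex.div_im, ← sub_div, Complex.normSq_apply η]
    congr 1
    simp
    ring
  rw [this]
  exact div_pos (mul_pos w.im_pos (by linarith)) (Complex.normSq_pos.2 hne)

theorem invCayley_cayley (w z : ℍ) : invCayley w (cayley w z) = z := by
  have h1 := sub_conj_ne_zero z w
  have h2 := one_sub_ne_zero_of_norm_lt_one (norm_cayley_lt_one w z)
  rw [invCayley, div_eq_iff h2, cayley]
  field_simp
  ring

theorem cayley_injective (w : ℍ) : Function.Injective (cayley w) := fun z z' h => by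
  ext
  rw [← invCayley_cayley w z, h, invCayley_cayley]

/-- A holomorphic self-map of the upper half plane, read in Cayley coordinates. -/
noncomputable def discMap (w v : ℍ) (g : ℍ → ℍ) (η : ℂ) : ℂ :=
  cayley v (g (ofComplex (invCayley w η)))

theorem discMap_cayley (w v : ℍ) (g : ℍ → ℍ) (z : ℍ) :
    discMap w v g (cayley w z) = cayley v (g z) := by
  rw [discMap, invCayley_cayley, ofComplex_apply]

theorem differentiableOn_discMap (w v : ℍ) {g : ℍ → ℍ}
    (hg : HolomorphicOnUpperHalfPlane fun z => (g z : ℂ)) :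
    DifferentiableOn ℂ (discMap w v g) (Metric.ball 0 1) := by
  have h1 : DifferentiableOn ℂ (invCayley w) (Metric.ball 0 1) := by
    refine DifferentiableOn.div (by fun_prop) (by fun_prop) fun η hη => ?_
    exact one_sub_ne_zero_of_norm_lt_one (by simpa using hη)
  have h2 : DifferentiableOn ℂ (fun η => (g (ofComplex (invCayley w η)) : ℂ)) (Metric.ball 0 1) :=
    DifferentiableOn.comp (g := fun z => (g (ofComplex z) : ℂ)) hg h1
      fun η hη => invCayley_im_pos w (by simpa using hη)
  exact (h2.sub_const _).div (h2.sub_const _) fun η _ => sub_conj_ne_zero _ _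

/-- The **Schwarz-Pick lemma** for the upper half plane. -/
theorem norm_cayley_le {g : ℍ → ℍ} (hg : HolomorphicOnUpperHalfPlane fun z => (g z : ℂ))
    (w z : ℍ) : ‖cayley (g w) (g z)‖ ≤ ‖cayley w z‖ := by
  have h0 : discMap w (g w) g 0 = 0 := by
    rw [← cayley_self w, discMap_cayley]
    simp
  have := Complex.norm_le_norm_of_mapsTo_ball (differentiableOn_discMap w (g w) hg)
    (fun η _ => mem_closedBall_zero_iff.2 (norm_cayley_lt_one _ _).le) h0 (norm_cayley_lt_one w z)
  rwa [discMap_cayley] at this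

/-- With `q = ‖z - w‖² / (im z * im w)`, the squared norm of `cayley w z` is `q / (q + 4)`,
increasing in `q`; so `q` does not increase under `g`. -/
theorem normSq_sub_mul_le {g : ℍ → ℍ} (hg : HolomorphicOnUpperHalfPlane fun z => (g z : ℂ))
    (w z : ℍ) : ‖(g z : ℂ) - g w‖ ^ 2 * (z.im * w.im) ≤
      ‖(z : ℂ) - w‖ ^ 2 * ((g z).im * (g w).im) := by
  have h := norm_cayley_le hg w z
  rw [← sq_le_sq₀ (norm_nonneg _) (norm_nonneg _), cayley, cayley, norm_div, norm_div, div_pow,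
    div_pow, normSq_sub_conj, normSq_sub_conj] at h
  have h1 := mul_pos z.im_pos w.im_pos
  have h2 := mul_pos (g z).im_pos (g w).im_pos
  rw [div_le_div_iff₀ (by positivity) (by positivity)] at h
  nlinarith

end SchwarzPick

/-! ### Automorphisms of the half plane and parabolicity. -/

section Automorphisms

open UpperHalfPlane ComplexConjugate

theorem sl_smul_denom_ne_zero (A : SL(2, ℝ)) (z : ℍ) : (A 1 0 : ℂ) * z + A 1 1 ≠ 0 := by
  exact denom_ne_zero (A : GL (Fin 2) ℝ) z

theorem coe_sl_smul (A : SL(2, ℝ)) (z : ℍ) :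
    ((A • z : ℍ) : ℂ) = ((A 0 0 : ℂ) * z + A 0 1) / ((A 1 0 : ℂ) * z + A 1 1) := by
  simpa using coe_specialLinearGroup_apply A z

theorem sl_det_eq (A : SL(2, ℝ)) : A 0 0 * A 1 1 - A 0 1 * A 1 0 = 1 := by
  have := A.det_coe
  rwa [Matrix.det_fin_two] at this

theorem HolomorphicOnUpperHalfPlane.sl_smul (A : SL(2, ℝ)) {g : ℍ → ℍ}
    (hg : HolomorphicOnUpperHalfPlane fun z => (g z : ℂ)) :
    HolomorphicOnUpperHalfPlane fun z => ((A • g z : ℍ) : ℂ) := by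
  simp only [HolomorphicOnUpperHalfPlane, coe_sl_smul]
  exact ((hg.const_mul _).add_const _).div ((hg.const_mul _).add_const _)
    fun z _ => sl_smul_denom_ne_zero A _

theorem HolomorphicOnUpperHalfPlane.comp {F : ℍ → ℂ} (hF : HolomorphicOnUpperHalfPlane F)
    {g : ℍ → ℍ} (hg : HolomorphicOnUpperHalfPlane fun z => (g z : ℂ)) :
    HolomorphicOnUpperHalfPlane fun z => F (g z) := by
  have := DifferentiableOn.comp (g := fun w => F (ofComplex w)) hF hg
    fun z _ => (g (ofComplex z)).im_pos
  simpa only [HolomorphicOnUpperHalfPlane, Function.comp_def, ofComplex_apply] using this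

theorem holomorphicOnUpperHalfPlane_coe : HolomorphicOnUpperHalfPlane fun z => (z : ℂ) :=
  differentiableOn_id.congr fun z hz => by simp [ofComplex_apply_of_im_pos hz]

/-- A rotation of the upper half plane around `i`. -/
theorem exists_cayley_smul_eq {c : ℂ} (hc : ‖c‖ = 1) :
    ∃ A : SL(2, ℝ), ∀ z : ℍ, cayley UpperHalfPlane.I (A • z) = c * cayley UpperHalfPlane.I z := by
  -- Half the argument, because a rotation matrix of angle `θ` turns the disc by `2θ`.
  obtain ⟨θ, hθ⟩ : ∃ θ : ℝ, Complex.exp (2 * (θ * Complex.I)) = c := by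
    refine ⟨Complex.arg c / 2, ?_⟩
    have := Complex.norm_mul_exp_arg_mul_I c
    rw [hc, Complex.ofReal_one, one_mul] at this
    rw [← mul_assoc, show (2 : ℂ) * ((Complex.arg c / 2 : ℝ) : ℂ) = Complex.arg c by
      push_cast; ring]
    exact this
  have hdet : Matrix.det !![Real.cos θ, Real.sin θ; -Real.sin θ, Real.cos θ] = 1 := by
    rw [Matrix.det_fin_two_of]
    nlinarith [Real.sin_sq_add_cos_sq θ]
  let A : SL(2, ℝ) := ⟨_, hdet⟩
  refine ⟨A, fun z => ?_⟩
  have h1 := sl_smul_denom_ne_zero A z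
  have h2 := sub_conj_ne_zero (A • z : ℍ) UpperHalfPlane.I
  have h3 := sub_conj_ne_zero z UpperHalfPlane.I
  rw [cayley, cayley, ← mul_div_assoc, div_eq_div_iff h2 h3, coe_sl_smul, coe_I, Complex.conj_I,
    ← hθ, two_mul, Complex.exp_add, Complex.exp_mul_I]
  have h4 : Complex.sin θ ^ 2 + Complex.cos θ ^ 2 = 1 := Complex.sin_sq_add_cos_sq θ
  have e00 : (A 0 0 : ℂ) = Complex.cos θ := by simp [A]
  have e01 : (A 0 1 : ℂ) = Complex.sin θ := by simp [A]
  have e10 : (A 1 0 : ℂ) = -Complex.sin θ := by simp [A]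
  have e11 : (A 1 1 : ℂ) = Complex.cos θ := by simp [A]
  rw [e10, e11] at h1
  rw [e00, e01, e10, e11]
  generalize Complex.cos θ = C at *
  generalize Complex.sin θ = S at *
  have h5 : C * z + S - Complex.I * (-S * z + C) = (C + S * Complex.I) * (z - Complex.I) := by
    linear_combination S * Complex.I_sq
  have h6 : C * z + S + Complex.I * (-S * z + C) = (C - S * Complex.I) * (z + Complex.I) := by
    linear_combination S * Complex.I_sq
  have h7 : (C + S * Complex.I) * (C - S * Complex.I) = 1 := by
    linear_combination h4 - S ^ 2 * Complex.I_sq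
  have e1 : (C * z + S) / (-S * z + C) - Complex.I
      = (C + S * Complex.I) * (z - Complex.I) / (-S * z + C) := by
    rw [eq_div_iff h1, sub_mul, div_mul_cancel₀ _ h1]
    exact h5
  have e2 : (C * z + S) / (-S * z + C) - -Complex.I
      = (C - S * Complex.I) * (z + Complex.I) / (-S * z + C) := by
    rw [eq_div_iff h1, sub_mul, div_mul_cancel₀ _ h1]
    linear_combination h6
  rw [e1, e2, div_mul_eq_mul_div, mul_div_assoc']
  congr 1
  linear_combination (-(C + S * Complex.I) * (z - Complex.I) * (z + Complex.I)) * h7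

/-- Holomorphic automorphisms of the upper half plane are given by `SL(2, ℝ)`. -/
theorem exists_eq_smul_of_holomorphic {γ γ' : ℍ → ℍ}
    (hγ : HolomorphicOnUpperHalfPlane fun z => (γ z : ℂ))
    (hγ' : HolomorphicOnUpperHalfPlane fun z => (γ' z : ℂ)) (hinv : ∀ z, γ' (γ z) = z) :
    ∃ A : SL(2, ℝ), ∀ z, γ z = A • z := by
  let B := (γ UpperHalfPlane.I).toSL2R
  have hB : B⁻¹ • γ UpperHalfPlane.I = UpperHalfPlane.I := inv_smul_eq_iff.2 (toSL2R_smul_I _).symm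
  let δ : ℍ → ℍ := fun z => B⁻¹ • γ z
  have hδ : HolomorphicOnUpperHalfPlane fun z => (δ z : ℂ) := hγ.sl_smul B⁻¹
  have hδI : δ UpperHalfPlane.I = UpperHalfPlane.I := hB
  let δ' : ℍ → ℍ := fun z => γ' (B • z)
  have hδ' : HolomorphicOnUpperHalfPlane fun z => (δ' z : ℂ) :=
    hγ'.comp (holomorphicOnUpperHalfPlane_coe.sl_smul B)
  have hδδ' : ∀ z, δ' (δ z) = z := fun z => by simp [δ, δ', hinv]
  have hnorm : ∀ z, ‖cayley UpperHalfPlane.I (δ z)‖ = ‖cayley UpperHalfPlane.I z‖ := by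
    intro z
    apply le_antisymm
    · have := norm_cayley_le hδ UpperHalfPlane.I z
      rwa [hδI] at this
    · have := norm_cayley_le hδ' UpperHalfPlane.I (δ z)
      have hI : δ' UpperHalfPlane.I = UpperHalfPlane.I := by
        conv_lhs => rw [← hδI]
        exact hδδ' UpperHalfPlane.I
      rwa [hI, hδδ'] at this
  have h0 : discMap UpperHalfPlane.I UpperHalfPlane.I δ 0 = 0 := by
    rw [← cayley_self UpperHalfPlane.I, discMap_cayley, hδI]
  -- The equality case of the Schwarz lemma: `δ` and its inverse both fix `i` and are contractions,
  -- so `δ` is a rotation in the disc.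
  obtain ⟨c, hc, hEq⟩ := Complex.affine_of_mapsTo_ball_of_exists_norm_dslope_eq_div'
    (f := discMap UpperHalfPlane.I UpperHalfPlane.I δ) (c := 0) (R₁ := 1) (R₂ := 1)
    (differentiableOn_discMap UpperHalfPlane.I UpperHalfPlane.I hδ)
    (fun η _ => by
      rw [h0]
      exact mem_closedBall_zero_iff.2 (norm_cayley_lt_one _ _).le) (by
      obtain ⟨z, hz⟩ : ∃ z : ℍ, z ≠ UpperHalfPlane.I := exists_ne UpperHalfPlane.I
      have hz0 : cayley UpperHalfPlane.I z ≠ 0 := fun h =>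
        hz (cayley_injective UpperHalfPlane.I (by rw [h, cayley_self]))
      refine ⟨cayley UpperHalfPlane.I z, by simpa using norm_cayley_lt_one UpperHalfPlane.I z, ?_⟩
      rw [dslope_of_ne _ hz0, slope_def_field, h0, sub_zero, sub_zero, discMap_cayley, norm_div,
        hnorm, div_self (norm_ne_zero_iff.2 hz0), div_one])
  rw [div_one] at hc
  obtain ⟨R, hR⟩ := exists_cayley_smul_eq hc
  refine ⟨B * R, fun z => ?_⟩
  have h1 : δ z = R • z := by
    apply cayley_injective UpperHalfPlane.I
    rw [hR, ← discMap_cayley UpperHalfPlane.I UpperHalfPlane.I,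
      hEq (by simpa using norm_cayley_lt_one UpperHalfPlane.I z), h0]
    simp [mul_comm]
  rw [mul_smul, ← h1]
  simp [δ]

/-- An element of `SL(2, ℝ)` without fixed points in the upper half plane, with an orbit relation
`g (z + 1) = A • g z` for a holomorphic `g`, is parabolic. -/
theorem isParabolic_of_holomorphic_period {A : SL(2, ℝ)} (hfix : ∀ z : ℍ, A • z ≠ z) {g : ℍ → ℍ}
    (hg : HolomorphicOnUpperHalfPlane fun z => (g z : ℂ))
    (hgA : ∀ z, g ((1 : ℝ) +ᵥ z) = A • g z) :
    (A : Matrix (Fin 2) (Fin 2) ℝ).IsParabolic := by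
  have hdet := sl_det_eq A
  refine ⟨?_, ?_⟩
  · rintro ⟨x, hx⟩
    apply hfix UpperHalfPlane.I
    have h := fun i j => congrFun (congrFun hx i) j
    have h00 := h 0 0
    have h01 := h 0 1
    have h10 := h 1 0
    have h11 := h 1 1
    simp at h00 h01 h10 h11
    have hx0 : (x : ℂ) ≠ 0 := by
      intro hx0
      have hx0 : x = 0 := by exact_mod_cast hx0
      rw [← h00, ← h01, hx0] at hdet
      simp at hdet
    ext
    rw [coe_sl_smul, ← h00, ← h01, ← h10, ← h11]
    simp only [Complex.ofReal_zero, zero_mul, zero_add, add_zero]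
    exact mul_div_cancel_left₀ _ hx0
  have hdisc : (A : Matrix (Fin 2) (Fin 2) ℝ).discr =
      (A 1 1 - A 0 0) ^ 2 + 4 * (A 0 1 * A 1 0) := by
    rw [Matrix.discr_fin_two, A.det_coe, Matrix.trace_fin_two]
    linear_combination 4 * hdet
  rw [hdisc]
  generalize hD : (A 1 1 - A 0 0) ^ 2 + 4 * (A 0 1 * A 1 0) = D
  apply le_antisymm
  · -- hyperbolic elements move all points by at least a fixed distance
    refine le_of_forall_pos_le_add fun ε hε => ?_
    -- Schwarz-Pick at `iy` and `iy + 1` will give `D ≤ 1 / y²`, so this `y` yields `D ≤ ε`.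
    have hy0 : 0 < √(1 / ε) := Real.sqrt_pos.2 (by positivity)
    have hy2 : √(1 / ε) ^ 2 * ε = 1 := by
      rw [Real.sq_sqrt (by positivity)]
      field_simp
    generalize √(1 / ε) = y at hy0 hy2
    let z : ℍ := ⟨⟨0, y⟩, hy0⟩
    have h := normSq_sub_mul_le hg z ((1 : ℝ) +ᵥ z)
    have hzim : z.im = y := rfl
    have hne := sl_smul_denom_ne_zero A (g z)
    have hN : 0 < Complex.normSq ((A 1 0 : ℂ) * g z + A 1 1) := Complex.normSq_pos.2 hne
    have him : (A • g z).im = (g z).im / Complex.normSq ((A 1 0 : ℂ) * g z + A 1 1) := by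
      rw [← coe_im, coe_sl_smul, Complex.div_im, ← sub_div]
      congr 1
      simp
      linear_combination (g z).im * hdet
    have hsub : ((A • g z : ℍ) : ℂ) - g z =
        -((A 1 0 : ℂ) * g z ^ 2 + (A 1 1 - A 0 0) * g z - A 0 1) /
          ((A 1 0 : ℂ) * g z + A 1 1) := by
      rw [coe_sl_smul, eq_div_iff hne, sub_mul, div_mul_cancel₀ _ hne]
      ring
    rw [hgA, hsub, him, vadd_im, hzim, coe_vadd, add_sub_cancel_right, norm_div, div_pow, norm_neg,
      ← Complex.normSq_eq_norm_sq, ← Complex.normSq_eq_norm_sq, ← Complex.normSq_eq_norm_sq,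
      div_mul_eq_mul_div, div_mul_eq_mul_div, mul_div_assoc', div_le_div_iff_of_pos_right hN] at h
    have hv := (g z).im_pos
    simp only [Complex.normSq_apply] at h
    simp [pow_two] at h
    generalize (g z).re = u at *
    generalize (g z).im = v at *
    generalize A 0 0 = p at *
    generalize A 0 1 = q at *
    generalize A 1 0 = c at *
    generalize A 1 1 = d at *
    -- With `Q = c * z² + (d - p) * z - q` at `z = u + iv`, one has `|Q|² = D * v² + (2 * c * v² +
    -- re Q)²`; the square in the hint is `y` times the last bracket.
    have key : v ^ 2 * (D * y ^ 2) ≤ v ^ 2 * 1 := by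
      rw [← hD]
      nlinarith [sq_nonneg (y * (2 * c * v ^ 2 + (c * (u * u - v * v) + (d - p) * u - q)))]
    have hDy : y ^ 2 * D ≤ y ^ 2 * ε := by
      linarith [le_of_mul_le_mul_left key (by positivity)]
    rw [zero_add]
    exact le_of_mul_le_mul_left hDy (by positivity)
  · by_contra! hneg
    have hc : A 1 0 ≠ 0 := by
      intro hc
      rw [hc] at hD
      nlinarith [sq_nonneg (A 1 1 - A 0 0)]
    -- The root of the fixed point equation in the upper half plane; the absolute value selects it
    -- whatever the sign of `A 1 0`.
    let z : ℂ := ⟨(A 0 0 - A 1 1) / (2 * A 1 0), √(-D) / |2 * A 1 0|⟩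
    have hz : 0 < z.im := div_pos (Real.sqrt_pos.2 (by linarith)) (by positivity)
    have hs : √(-D) ^ 2 = -D := Real.sq_sqrt (by linarith)
    have hquad : (A 1 0 : ℂ) * z ^ 2 + (A 1 1 - A 0 0) * z - A 0 1 = 0 := by
      have him : z.im ^ 2 = -D / (2 * A 1 0) ^ 2 := by
        rw [div_pow, hs, sq_abs]
      have hre : z.re = (A 0 0 - A 1 1) / (2 * A 1 0) := rfl
      apply Complex.ext
      · simp [pow_two]
        rw [← pow_two z.im, him, hre, ← hD]
        field_simp
        ring
      · simp [pow_two]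
        rw [hre]
        field_simp
        ring
    apply hfix ⟨z, hz⟩
    ext
    rw [coe_sl_smul, div_eq_iff (sl_smul_denom_ne_zero A _)]
    change (A 0 0 : ℂ) * z + A 0 1 = z * (A 1 0 * z + A 1 1)
    linear_combination -hquad

end Automorphisms

/-! ### Deck transformations as elements of `SL(2, ℝ)`. -/

section HolomorphicLifts

open UpperHalfPlane

theorem analyticAt_awayCoord_sphereParam {p c : OnePoint ℂ} {w₀ : ℂ} (h : sphereParam p w₀ ≠ c) :
    AnalyticAt ℂ (fun w => awayCoord c (sphereParam p w)) w₀ := by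
  induction p using OnePoint.rec with
  | infty =>
    induction c using OnePoint.rec with
    | infty =>
      have hw : w₀ ≠ 0 := fun hw => h (by simp [hw])
      refine (analyticAt_id.inv hw).congr ?_
      filter_upwards [isOpen_ne.mem_nhds hw] with w hw
      rw [sphereParam_infty, if_neg hw]
      rfl
    | coe c =>
      have hw : 1 - c * w₀ ≠ 0 := by
        intro hw
        have hw0 : w₀ ≠ 0 := by
          rintro rfl
          simp at hw
        apply h
        rw [sphereParam_infty, if_neg hw0, inv_eq_of_mul_eq_one_left (a := c)]
        linear_combination -hw
      refine (analyticAt_id.div (analyticAt_const.sub (analyticAt_const.mul analyticAt_id))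
        hw).congr (Filter.Eventually.of_forall fun w => ?_)
      by_cases hw0 : w = 0
      · simp [hw0]
      · change w / (1 - c * w) = awayCoord c (sphereParam OnePoint.infty w)
        rw [sphereParam_infty, if_neg hw0, awayCoord_coe_coe,
          show w⁻¹ - c = (1 - c * w) / w by field_simp, inv_div]
  | coe p =>
    induction c using OnePoint.rec with
    | infty => exact analyticAt_const.add analyticAt_id
    | coe c =>
      refine ((analyticAt_const.add analyticAt_id).sub analyticAt_const).inv fun hw => h ?_
      rw [sphereParam_coe, show p + w₀ = c from sub_eq_zero.1 hw]

/-- Since the covering omits `a k`, this replaces it by a single complex-valued holomorphic function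
on all of `ℍ`. -/
theorem IsHolomorphicToSphere.analyticAt_awayCoord {g : ℍ → OnePoint ℂ}
    (hg : IsHolomorphicToSphere g) {c : OnePoint ℂ} {τ : ℍ} (hc : g τ ≠ c) :
    AnalyticAt ℂ (fun w => awayCoord c (g (ofComplex w))) τ := by
  obtain ⟨u, hu, hgu⟩ := hg τ
  have hu0 : u τ = 0 := by
    apply sphereParam_injective (g τ)
    rw [sphereParam_zero]
    exact hgu.self_of_nhds.symm
  have h1 : AnalyticAt ℂ (fun w => awayCoord c (sphereParam (g τ) (u w))) τ := by
    refine AnalyticAt.fun_comp (g := fun w => awayCoord c (sphereParam (g τ) w)) ?_ hu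
    rw [hu0]
    exact analyticAt_awayCoord_sphereParam (by rwa [sphereParam_zero])
  refine h1.congr ?_
  have h2 := isOpenEmbedding_coe.map_nhds_eq τ
  rw [Filter.EventuallyEq, ← h2, Filter.eventually_map]
  filter_upwards [hgu] with z hz
  rw [ofComplex_apply, hz]

variable {n : ℕ} {a : Fin n → OnePoint ℂ} {f : ℍ → PuncturedSphere a}

/-- A continuous self-map `g` of the upper half plane is holomorphic if its composition with the
universal covering is. -/
theorem IsUniversalCovering.holomorphic_of_comp (hf : IsUniversalCovering a f) (k : Fin n)
    {g : ℍ → ℍ} (hg : Continuous g)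
    (hfg : ∀ τ : ℍ, AnalyticAt ℂ (fun w => awayCoord (a k) (f (g (ofComplex w)))) τ) :
    HolomorphicOnUpperHalfPlane fun z => (g z : ℂ) := by
  have hne : ∀ τ, (f τ : OnePoint ℂ) ≠ a k := fun τ h => (f τ).2 ⟨k, h.symm⟩
  intro w hw
  apply DifferentiableAt.differentiableWithinAt
  apply AnalyticAt.differentiableAt
  let τ : ℍ := ⟨w, hw⟩
  obtain ⟨e, he, hfe⟩ := hf.isCoveringMap.isLocalHomeomorph (g τ)
  refine analyticAt_of_comp_injOn (F := fun w => awayCoord (a k) (f (ofComplex w)))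
    (h := fun w => (g (ofComplex w) : ℂ)) (z₀ := (τ : ℂ)) (W := ((↑) : ℍ → ℂ) '' e.source)
    ?_ ?_ ?_ ?_ ?_
  · exact hf.holomorphic.analyticAt_awayCoord (hne _)
  · exact (isOpenEmbedding_coe.isOpenMap _ e.open_source).mem_nhds
      ⟨g τ, he, by rw [ofComplex_apply]⟩
  · rintro _ ⟨x, hx, rfl⟩ _ ⟨y, hy, rfl⟩ hxy
    simp only [ofComplex_apply] at hxy
    have := Subtype.ext (awayCoord_injOn (a k) (hne x) (hne y) hxy)
    rw [hfe] at this
    rw [e.injOn hx hy this]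
  · filter_upwards [(isOpen_lt continuous_const Complex.continuous_im).mem_nhds hw] with z hz
    exact UpperHalfPlane.continuous_coe.continuousAt.comp
      (hg.continuousAt.comp (contMDiffAt_ofComplex (n := 0) hz).continuousAt)
  · simpa only [ofComplex_apply] using hfg τ

/-- Deck transformations of the universal covering are given by `SL(2, ℝ)`. -/
theorem IsUniversalCovering.exists_deckGroup_eq_smul (hf : IsUniversalCovering a f) (k : Fin n)
    (γ : deckGroup f) : ∃ A : SL(2, ℝ), ∀ z, (γ : ℍ ≃ₜ ℍ) z = A • z := by
  have hol : ∀ γ : deckGroup f, HolomorphicOnUpperHalfPlane fun z => ((γ : ℍ ≃ₜ ℍ) z : ℂ) := by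
    intro γ
    refine hf.holomorphic_of_comp k (γ : ℍ ≃ₜ ℍ).continuous fun τ => ?_
    simp only [apply_deckGroup]
    exact hf.holomorphic.analyticAt_awayCoord fun h => (f τ).2 ⟨k, h.symm⟩
  exact exists_eq_smul_of_holomorphic (hol γ) (hol γ⁻¹) fun z =>
    (γ : ℍ ≃ₜ ℍ).symm_apply_apply z

/-- A nontrivial deck transformation that is the monodromy of a punctured disc is parabolic. -/
theorem IsUniversalCovering.isParabolicTransformation (hf : IsUniversalCovering a f) (k : Fin n)
    {γ : deckGroup f} (hγ : γ ≠ 1) {p : OnePoint ℂ} {r : ℝ} {g : ℍ → ℍ} (hg : Continuous g)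
    (hfg : ∀ z : ℍ, (f (g z) : OnePoint ℂ) =
      sphereParam p (r * Complex.exp (2 * Real.pi * Complex.I * z)))
    (hgγ : ∀ z, g ((1 : ℝ) +ᵥ z) = (γ : ℍ ≃ₜ ℍ) (g z)) :
    IsParabolicTransformation (γ : ℍ ≃ₜ ℍ) := by
  obtain ⟨A, hA⟩ := hf.exists_deckGroup_eq_smul k γ
  refine ⟨A, isParabolic_of_holomorphic_period (fun z hz => hγ ?_) (g := g) ?_ fun z => ?_, hA⟩
  · exact deckGroup_ext hf.isCoveringMap (z := z) ((hA z).trans hz)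
  · refine hf.holomorphic_of_comp k hg fun τ => ?_
    have h1 : AnalyticAt ℂ (fun w => awayCoord (a k)
        (sphereParam p (r * Complex.exp (2 * Real.pi * Complex.I * w)))) τ := by
      refine AnalyticAt.fun_comp (g := fun w => awayCoord (a k) (sphereParam p w))
        (analyticAt_awayCoord_sphereParam ?_) (by fun_prop)
      rw [← hfg]
      exact fun h => (f (g τ)).2 ⟨k, h.symm⟩
    refine h1.congr ?_
    rw [Filter.EventuallyEq, ← isOpenEmbedding_coe.map_nhds_eq τ, Filter.eventually_map]
    exact Filter.Eventually.of_forall fun z => by rw [ofComplex_apply, hfg]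
  · rw [hgγ, hA]

end HolomorphicLifts

/-! ### Loops around a puncture and lifts of punctured discs. -/

section PuncturedDisc

open UpperHalfPlane

theorem exists_exp_two_pi_I_eq {w : ℂ} (h0 : w ≠ 0) (h1 : ‖w‖ < 1) :
    ∃ z : ℍ, Complex.exp (2 * Real.pi * Complex.I * z) = w := by
  refine ⟨⟨_, Function.Periodic.im_invQParam_pos_of_norm_lt_one one_pos h1 h0⟩, ?_⟩
  have := Function.Periodic.qParam_right_inv one_ne_zero h0
  rw [Function.Periodic.qParam, Complex.ofReal_one, div_one] at this
  exact this

theorem exists_mul_exp_two_pi_I_eq {r : ℝ} {w : ℂ} (h0 : w ≠ 0) (h1 : ‖w‖ < r) :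
    ∃ z : ℍ, r * Complex.exp (2 * Real.pi * Complex.I * z) = w := by
  have hr : 0 < r := (norm_nonneg w).trans_lt h1
  have hr' : (r : ℂ) ≠ 0 := by exact_mod_cast hr.ne'
  obtain ⟨z, hz⟩ := exists_exp_two_pi_I_eq (div_ne_zero h0 hr') (by
    rwa [norm_div, Complex.norm_real, Real.norm_of_nonneg hr.le, div_lt_one hr])
  exact ⟨z, by rw [hz, mul_div_cancel₀ _ hr']⟩

theorem exp_two_pi_I_vadd (t : ℝ) (z : ℍ) :
    Complex.exp (2 * Real.pi * Complex.I * (t +ᵥ z : ℍ)) =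
      Complex.exp (2 * Real.pi * Complex.I * z) * Complex.exp (2 * Real.pi * Complex.I * t) := by
  rw [← Complex.exp_add, coe_vadd]
  ring_nf

theorem continuous_vadd_const (z : ℍ) : Continuous fun t : ℝ => t +ᵥ z := by
  rw [isEmbedding_coe.continuous_iff]
  simp only [Function.comp_def, coe_vadd]
  fun_prop

variable {n : ℕ} {a : Fin n → OnePoint ℂ} {f : ℍ → PuncturedSphere a} {p : OnePoint ℂ}

theorem not_mem_closedBall_of_lift {r : ℝ} {g : ℍ → ℍ}
    (hfg : ∀ z : ℍ, (f (g z) : OnePoint ℂ) =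
      sphereParam p (r * Complex.exp (2 * Real.pi * Complex.I * z)))
    {ρ : ℝ} (hρ : ρ < r) (i : Fin n) (hi : a i ≠ p) :
    a i ∉ sphereParam p '' Metric.closedBall (0 : ℂ) ρ := by
  rintro ⟨w, hw, hwi⟩
  have hw0 : w ≠ 0 := by
    rintro rfl
    exact hi (by rw [← hwi, sphereParam_zero])
  obtain ⟨z, hz⟩ := exists_mul_exp_two_pi_I_eq hw0 ((mem_closedBall_zero_iff.1 hw).trans_lt hρ)
  exact (f (g z)).2 ⟨i, by rw [hfg, hz, hwi]⟩

/-- The monodromy of a punctured disc corresponds to a loop around the puncture. -/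
theorem exists_isLoopAround (hf : Continuous f) {γ : deckGroup f} {r : ℝ} (hr : 0 < r)
    {g : ℍ → ℍ} (hg : Continuous g)
    (hfg : ∀ z : ℍ, (f (g z) : OnePoint ℂ) =
      sphereParam p (r * Complex.exp (2 * Real.pi * Complex.I * z)))
    (hgγ : ∀ z, g ((1 : ℝ) +ᵥ z) = (γ : ℍ ≃ₜ ℍ) (g z)) (τ₀ : ℍ) :
    ∃ l : Path (f τ₀) (f τ₀), IsLoopAround p l ∧ CorrespondsToLoop f τ₀ (γ : ℍ ≃ₜ ℍ) l := by
  let i : ℍ := UpperHalfPlane.I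
  let δ : Path τ₀ (g i) := PathConnectedSpace.somePath _ _
  -- On `[-1, 2]`: a tail `δ` from `τ₀`, one turn of the lifted circle, and the `γ`-image of the
  -- tail run backwards.
  let W : ℝ → ℍ := fun x => if x ≤ 0 then δ.extend (x + 1) else
    if x ≤ 1 then g (x +ᵥ i) else (γ : ℍ ≃ₜ ℍ) (δ.extend (2 - x))
  have hW : Continuous W := by
    refine Continuous.if_le (by fun_prop) (Continuous.if_le
      (hg.comp (continuous_vadd_const i)) ((γ : ℍ ≃ₜ ℍ).continuous.comp (by fun_prop))
      continuous_id continuous_const fun x hx => ?_) continuous_id continuous_const fun x hx => ?_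
    · obtain rfl : x = 1 := hx
      rw [hgγ, show (2 : ℝ) - 1 = 1 by norm_num, δ.extend_one]
    · obtain rfl : x = 0 := hx
      simp
  have hW1 : ∀ x, 0 ≤ x → x ≤ 1 → W x = g (x +ᵥ i) := by
    intro x h0 h1
    rcases h0.eq_or_lt with rfl | h0
    · simp [W]
    · simp [W, h0.not_ge, h1]
  have hW0 : ∀ s, 0 ≤ s → s ≤ 1 → f (W (s - 1)) = f (δ.extend s) := by
    intro s h0 h1
    simp [W, h1]
  have hW2 : ∀ s, 0 ≤ s → s ≤ 1 → W (2 - s) = (γ : ℍ ≃ₜ ℍ) (δ.extend s) := by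
    intro s h0 h1
    rcases h1.eq_or_lt with rfl | h1
    · rw [show (2 : ℝ) - 1 = 1 by norm_num, hW1 1 zero_le_one le_rfl, hgγ, δ.extend_one]
    · have e1 : ¬ 2 - s ≤ 0 := by linarith
      have e2 : ¬ 2 - s ≤ 1 := by linarith
      simp [W, e1, e2]
  let L : Path τ₀ ((γ : ℍ ≃ₜ ℍ) τ₀) :=
    { toFun := fun t => W (3 * t - 1)
      continuous_toFun := by fun_prop
      source' := by simp [W]
      target' := by
        have := hW2 0 le_rfl zero_le_one
        rw [δ.extend_zero] at this
        rw [← this]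
        norm_num }
  -- The free homotopy shrinks the parameter interval `[s - 1, 2 - s]` from `[-1, 2]` to `[0, 1]`;
  -- its ends lie on the two tails and differ by `γ`. The radius is that of the circle lifted along
  -- `im z = 1`.
  refine ⟨(L.map hf).cast rfl (apply_deckGroup γ τ₀).symm, ⟨r * Real.exp (-(2 * Real.pi)),
    by positivity, not_mem_closedBall_of_lift hfg ?_, ⟨fun x => f (W ((3 - 2 * x.1) * x.2 -
      (1 - x.1))), by fun_prop⟩, fun t => ?_, fun t => ?_, fun s => ?_⟩, L, fun t => rfl⟩
  · exact mul_lt_of_lt_one_right hr (Real.exp_lt_one_iff.2 (by linarith [Real.pi_pos]))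
  · simp [L]
  · have e : (3 - 2 * ((1 : I) : ℝ)) * t - (1 - ((1 : I) : ℝ)) = t := by
      simp only [Set.Icc.coe_one]
      ring
    simp only [ContinuousMap.coe_mk, e]
    rw [hW1 t t.2.1 t.2.2, hfg, exp_two_pi_I_vadd, ← mul_assoc]
    congr 3
    push_cast
    congr 2
    simp [i]
    linear_combination 2 * Real.pi * Complex.I_mul_I
  · have e0 : (3 - 2 * (s : ℝ)) * ((0 : I) : ℝ) - (1 - s) = s - 1 := by simp
    have e1 : (3 - 2 * (s : ℝ)) * ((1 : I) : ℝ) - (1 - s) = 2 - s := by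
      simp only [Set.Icc.coe_one]
      ring
    simp only [ContinuousMap.coe_mk, e0, e1]
    rw [hW0 s s.2.1 s.2.2, hW2 s s.2.1 s.2.2]
    exact (apply_deckGroup γ _).symm

/-- The monodromies of two concentric punctured discs are conjugate. -/
theorem exists_conj_of_lifts (hf : IsCoveringMap f) {γ₁ γ₂ : deckGroup f} {r₁ r₂ : ℝ}
    (hr₁ : 0 < r₁) (hr₂ : 0 < r₂) {g₁ g₂ : ℍ → ℍ} (hg₁ : Continuous g₁) (hg₂ : Continuous g₂)
    (hfg₁ : ∀ z : ℍ, (f (g₁ z) : OnePoint ℂ) =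
      sphereParam p (r₁ * Complex.exp (2 * Real.pi * Complex.I * z)))
    (hfg₂ : ∀ z : ℍ, (f (g₂ z) : OnePoint ℂ) =
      sphereParam p (r₂ * Complex.exp (2 * Real.pi * Complex.I * z)))
    (hγ₁ : ∀ z, g₁ ((1 : ℝ) +ᵥ z) = (γ₁ : ℍ ≃ₜ ℍ) (g₁ z))
    (hγ₂ : ∀ z, g₂ ((1 : ℝ) +ᵥ z) = (γ₂ : ℍ ≃ₜ ℍ) (g₂ z)) :
    ∃ h : deckGroup f, γ₁ * h = h * γ₂ := by
  obtain ⟨ρ, hρ0, hρ⟩ := exists_between (lt_min hr₁ hr₂)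
  have hρ' : (ρ : ℂ) ≠ 0 := by exact_mod_cast hρ0.ne'
  have hnorm : ‖(ρ : ℂ)‖ = ρ := by rw [Complex.norm_real, Real.norm_of_nonneg hρ0.le]
  obtain ⟨z₁, hz₁⟩ := exists_mul_exp_two_pi_I_eq (r := r₁) hρ' (by
    rw [hnorm]
    exact hρ.trans_le (min_le_left _ _))
  obtain ⟨z₂, hz₂⟩ := exists_mul_exp_two_pi_I_eq (r := r₂) hρ' (by
    rw [hnorm]
    exact hρ.trans_le (min_le_right _ _))
  -- Both lifts restrict to lifts of the same circle of radius `ρ`, so they differ by one deck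
  -- transformation there; one full turn compares the monodromies.
  have key : ∀ t : ℝ, f (g₂ (t +ᵥ z₂)) = f (g₁ (t +ᵥ z₁)) := fun t => by
    apply Subtype.ext
    rw [hfg₁, hfg₂, exp_two_pi_I_vadd, exp_two_pi_I_vadd, ← mul_assoc, ← mul_assoc, hz₁, hz₂]
  obtain ⟨h, hh⟩ := exists_deckGroup_apply_eq hf (key 0)
  have := hf.eq_of_comp_eq (g₁ := fun t : ℝ => g₁ (t +ᵥ z₁))
    (g₂ := fun t : ℝ => (h : ℍ ≃ₜ ℍ) (g₂ (t +ᵥ z₂))) (hg₁.comp (continuous_vadd_const _))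
    ((h : ℍ ≃ₜ ℍ).continuous.comp (hg₂.comp (continuous_vadd_const _)))
    (funext fun t => by simp only [Function.comp, apply_deckGroup, key]) 0 hh.symm
  have h1 := congrFun this 1
  simp only [hγ₁, hγ₂] at h1
  rw [zero_vadd, zero_vadd] at hh
  rw [← hh] at h1
  exact ⟨h, deckGroup_ext hf (z := g₂ z₂) h1⟩

/-- The half plane parametrizes an open punctured disc, so the circle of radius `r` is reached only
from a strictly larger one. -/
theorem exists_larger_disc {r : ℝ}
    (h : ∀ i, a i ≠ p → a i ∉ sphereParam p '' Metric.closedBall (0 : ℂ) r) :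
    ∃ r' > r, ∀ i, a i ≠ p → a i ∉ sphereParam p '' Metric.closedBall (0 : ℂ) r' := by
  have : ∀ᶠ r' in 𝓝[>] r, ∀ i, a i ≠ p →
      a i ∉ sphereParam p '' Metric.closedBall (0 : ℂ) r' := by
    refine Filter.eventually_all.2 fun i => ?_
    by_cases hw : a i ≠ p ∧ ∃ w, sphereParam p w = a i
    · obtain ⟨hi, w, hw⟩ := hw
      have hrw : r < ‖w‖ := by
        by_contra! hle
        exact h i hi ⟨w, mem_closedBall_zero_iff.2 hle, hw⟩
      filter_upwards [Ioo_mem_nhdsGT hrw] with r' hr' _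
      rintro ⟨w', hw', he⟩
      rw [sphereParam_injective p (he.trans hw.symm)] at hw'
      exact (mem_closedBall_zero_iff.1 hw').not_gt hr'.2
    · refine Filter.Eventually.of_forall fun r' hi => ?_
      rintro ⟨w, -, hw'⟩
      exact hw ⟨hi, w, hw'⟩
  obtain ⟨r', h1, h2⟩ := (this.and self_mem_nhdsWithin).exists
  exact ⟨r', h2, h1⟩

/-- A deck transformation that corresponds to a loop around a puncture is the monodromy of a
punctured disc. -/
theorem exists_lift_of_isLoopAround (hf : IsCoveringMap f) {j : Fin n} {γ : deckGroup f} {τ₀ : ℍ}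
    {l : Path (f τ₀) (f τ₀)} (hl : IsLoopAround (a j) l)
    (hγ : CorrespondsToLoop f τ₀ (γ : ℍ ≃ₜ ℍ) l) :
    ∃ r : ℝ, 0 < r ∧ ∃ g : ℍ → ℍ, Continuous g ∧
      (∀ z : ℍ, (f (g z) : OnePoint ℂ) =
        sphereParam (a j) (r * Complex.exp (2 * Real.pi * Complex.I * z))) ∧
      ∀ z, g ((1 : ℝ) +ᵥ z) = (γ : ℍ ≃ₜ ℍ) (g z) := by
  obtain ⟨r, hr, hdisc, H, H0, H1, Hloop⟩ := hl
  obtain ⟨L, hL⟩ := hγ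
  have hH0 : ∀ t, H (0, t) = f ((L : C(I, ℍ)) t) := fun t => (H0 t).trans (hL t).symm
  let G := hf.liftHomotopy H L hH0
  have hfG : ∀ x, f (G x) = H x := congrFun (hf.liftHomotopy_lifts H L hH0)
  have hG0 : ∀ t, G (0, t) = L t := hf.liftHomotopy_zero H L hH0
  -- The free homotopy moves the base point, but the two ends of the lifted loop stay related by the
  -- same `γ`, so `γ` is also the monodromy of the final circle.
  have hG : (fun s : I => G (s, 1)) = fun s : I => (γ : ℍ ≃ₜ ℍ) (G (s, 0)) := by
    refine hf.eq_of_comp_eq (by fun_prop) ((γ : ℍ ≃ₜ ℍ).continuous.comp (by fun_prop))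
      (funext fun s => ?_) 0 ?_
    · simp only [Function.comp, apply_deckGroup, hfG, Hloop]
    · rw [hG0, hG0, L.source, L.target]
  have hG1 : G (1, 1) = (γ : ℍ ≃ₜ ℍ) (G (1, 0)) := congrFun hG 1
  obtain ⟨r', hrr', hdisc'⟩ := exists_larger_disc hdisc
  have hr' : 0 < r' := hr.trans hrr'
  have hr0 : (r' : ℂ) ≠ 0 := by exact_mod_cast hr'.ne'
  have hmem : ∀ z : ℍ,
      sphereParam (a j) (r' * Complex.exp (2 * Real.pi * Complex.I * z)) ∉ Set.range a := by
    rintro z ⟨i, hi⟩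
    by_cases hij : a i = a j
    · exact mul_ne_zero hr0 (Complex.exp_ne_zero _)
        (sphereParam_injective (a j) (by rw [← hi, hij, sphereParam_zero]))
    · refine hdisc' i hij ⟨_, mem_closedBall_zero_iff.2 ?_, hi.symm⟩
      rw [norm_mul, Complex.norm_real, Real.norm_of_nonneg hr'.le]
      exact mul_le_of_le_one_right hr'.le (UpperHalfPlane.norm_exp_two_pi_I_lt_one z).le
  let e : C(ℍ, PuncturedSphere a) := ⟨fun z => ⟨_, hmem z⟩, Continuous.subtype_mk
    (Continuous.sphereParam (by fun_prop)
      (fun z => mul_ne_zero hr0 (Complex.exp_ne_zero _)) (a j)) _⟩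
  obtain ⟨z₀, hz₀⟩ := exists_mul_exp_two_pi_I_eq (r := r') (w := r) (by exact_mod_cast hr.ne') (by
    rwa [Complex.norm_real, Real.norm_of_nonneg hr.le])
  have he : ∀ t : I, e ((t : ℝ) +ᵥ z₀) = H (1, t) := by
    intro t
    apply Subtype.ext
    rw [H1]
    change sphereParam (a j) (r' * Complex.exp (2 * Real.pi * Complex.I * ((t : ℝ) +ᵥ z₀ : ℍ))) = _
    rw [exp_two_pi_I_vadd, ← mul_assoc, hz₀]
  obtain ⟨g, ⟨hg0, hfg⟩, -⟩ := hf.existsUnique_continuousMap_lifts e z₀ (G (1, 0)) (by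
    rw [hfG, ← he 0, Set.Icc.coe_zero, zero_vadd])
  have hfg : ∀ z, f (g z) = e z := congrFun hfg
  have hgG : (fun t : I => g ((t : ℝ) +ᵥ z₀)) = fun t : I => G (1, t) := by
    refine hf.eq_of_comp_eq (g.continuous.comp ((continuous_vadd_const z₀).comp
      continuous_subtype_val)) (by fun_prop) (funext fun t => ?_) 0 ?_
    · simp only [Function.comp, hfg, hfG, he]
    · rw [Set.Icc.coe_zero, zero_vadd, hg0]
  have hg1 : g ((1 : ℝ) +ᵥ z₀) = (γ : ℍ ≃ₜ ℍ) (g z₀) := by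
    have := congrFun hgG 1
    rw [Set.Icc.coe_one] at this
    rw [this, hG1, hg0]
  refine ⟨r', hr', g, g.continuous, fun z => by rw [hfg]; rfl, congrFun ?_⟩
  refine hf.eq_of_comp_eq ?_ ((γ : ℍ ≃ₜ ℍ).continuous.comp g.continuous) (funext fun z => ?_) z₀ hg1
  · refine g.continuous.comp ?_
    rw [isEmbedding_coe.continuous_iff]
    simp only [Function.comp_def, coe_vadd]
    fun_prop
  · simp only [Function.comp, apply_deckGroup, hfg]
    apply Subtype.ext
    change sphereParam (a j) _ = sphereParam (a j) _
    rw [exp_two_pi_I_vadd, Complex.ofReal_one, mul_one, Complex.exp_two_pi_mul_I, mul_one]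

end PuncturedDisc

/-! ### The theorem. -/

theorem FreeGroupBasis.apply_ne_one {ι G : Type*} [Group G] (b : FreeGroupBasis ι G) (i : ι) :
    b i ≠ 1 := fun h => by
  have := b.repr_apply_coe i
  rw [h, map_one] at this
  exact FreeGroup.of_ne_one i this.symm

theorem theorem3p6 (n : ℕ) (hn : 3 ≤ n) (a : Fin n → OnePoint ℂ) (ha : Function.Injective a)
    (f : ℍ → PuncturedSphere a) (hf : IsUniversalCovering a f) :
    -- `Aut(f)` is free on `n - 1` parabolic generators, one for each puncture but an arbitrary one
    (∀ (τ₀ : ℍ) (k : Fin n), ∃ b : FreeGroupBasis {j : Fin n // j ≠ k} (deckGroup f),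
      ∀ j : {j : Fin n // j ≠ k},
        (∃ l : Path (f τ₀) (f τ₀), IsLoopAround (a j) l ∧
          CorrespondsToLoop f τ₀ (b j : ℍ ≃ₜ ℍ) l) ∧
        IsParabolicTransformation (b j : ℍ ≃ₜ ℍ)) ∧
    -- every deck transformation that corresponds to a loop around one puncture is parabolic
    (∀ γ ∈ deckGroup f, ∀ (τ₀ : ℍ) (l : Path (f τ₀) (f τ₀)) (j : Fin n),
      IsLoopAround (a j) l → CorrespondsToLoop f τ₀ γ l → IsParabolicTransformation γ) := by
  refine ⟨fun τ₀ k => ?_, fun γ hγ τ₀ l j hl hγl => ?_⟩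
  · obtain ⟨b, hb⟩ := exists_freeGroupBasis_puncturedSphere ha hf.isCoveringMap hf.surjective k
    refine ⟨b, fun j => ?_⟩
    obtain ⟨r, hr, g, hg, hfg, hgb⟩ := hb j
    exact ⟨exists_isLoopAround hf.isCoveringMap.continuous hr hg hfg hgb τ₀,
      hf.isParabolicTransformation k (b.apply_ne_one j) hg hfg hgb⟩
  · obtain ⟨r, hr, g, hg, hfg, hgγ⟩ :=
      exists_lift_of_isLoopAround (γ := ⟨γ, hγ⟩) hf.isCoveringMap hl hγl
    have : Nontrivial (Fin n) := Fin.nontrivial_iff_two_le.2 (by omega)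
    -- Omitting a puncture other than `a j` makes the monodromy at `a j` a basis element, hence
    -- nontrivial, and `γ` is conjugate to it.
    obtain ⟨k, hk⟩ := exists_ne j
    obtain ⟨b, hb⟩ := exists_freeGroupBasis_puncturedSphere ha hf.isCoveringMap hf.surjective k
    obtain ⟨r', hr', g', hg', hfg', hgb⟩ := hb ⟨j, hk.symm⟩
    obtain ⟨h, hh⟩ := exists_conj_of_lifts hf.isCoveringMap hr hr' hg hg' hfg hfg' hgγ hgb
    refine hf.isParabolicTransformation (γ := ⟨γ, hγ⟩) k (fun h1 => ?_) hg hfg hgγ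
    rw [h1, one_mul, left_eq_mul] at hh
    exact b.apply_ne_one _ hh
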